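/- Let $V$ be a Euclidean space with scalar product $\langle\cdot,\cdot\rangle$ and let $\alpha_1,\dots,\alpha_n$ be a basis of $V$ that is a set of simple roots of type $A_1$, $B_n$ or $C_n$: with $\alpha_j^\vee=2\alpha_j/\langle\alpha_j,\alpha_j\rangle$, the matrix $\langle\alpha_i,\alpha_j^\vee\rangle$ is the Cartan matrix of that type (standard numbering: for $C_n$ the root $\alpha_n$ is the long one, for $B_n$ it is the short one). Let $W$ be the Weyl group, generated by the reflections $r_i$ in the $\alpha_i$, let $\xi=m_1\alpha_1+\dots+m_n\alpha_n$ be the highest root of the root system $W\{\alpha_1,\dots,\alpha_n\}$, $r_\xi$ the orthogonal reflection in the hyperplane $\xi^\perp$, $r_0a=r_\xi a+2\xi/\langle\xi,\xi\rangle$, and let $W^{\mathrm{aff}}=\langle r_0,r_1,\dots,r_n\rangle$. Let $$P^\vee=\{v:\langle v,\alpha_i\rangle\in\mathbb Z\ \forall i\},\qquad P=\{v:\langle v,\alpha_i^\vee\rangle\in\mathbb Z\ \forall i\}.$$ A nontrivial admissible shift is a vector $\rho^\vee\notin P^\vee$ for which $\rho^\vee+P^\vee$ is $W$-invariant; a nontrivial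 admissible dual shift is a vector $\rho\notin P$ for which $\rho+P$ is $W$-invariant. Let $\sigma$ be one of the homomorphisms $\mathfrak 1,\sigma^e,\sigma^s,\sigma^l:W\to\{\pm1\}$, where $\mathfrak 1(r_i)=1$ and $\sigma^e(r_i)=-1$ for all $i$, $\sigma^s(r_i)=-1$ exactly for the short $\alpha_i$, and $\sigma^l(r_i)=-1$ exactly for the long $\alpha_i$ (the last two for types with two root lengths). For $\rho$ equal to $0$ or an admissible dual shift, and for $f\in W^{\mathrm{aff}}$, $f(a)=wa+q$ with $w\in W$, put $\gamma^\sigma_\rho(f)=e^{2\pi i\langle q,\rho\rangle}\sigma(w)$. Let $$F=\{a:\langle\alpha_i,a\rangle\ge0\ \forall i,\ \langle\xi,a\rangle\le1\},\qquad F^\sigma(\rho)=\{a\in F:\gamma^\sigma_\rho(f)=1\text{ for all }f\in W^{\mathrm{aff}}\text{ with }f(a)=a\},$$ and, for an integer $M\ge1$, $F^\sigma_M(\rho,\rho^\vee)=\tfrac1M(\rho^\vee+P^\vee)\cap F^\sigma(\rho)$. For integers $k\ge 1-n$ put $$\nu_n(2k)=\binom{n+k}{n}+\binom{n+k-1}{n},\qquad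 \nu_n(2k+1)=2\binom{n+k}{n},$$ with $\binom{a}{n}=0$ for $0\le a<n$. Then for every $M\ge1$, every nontrivial admissible shift $\rho^\vee$ and every nontrivial admissible dual shift $\rho$ (where these occur), the grids are finite and: 1. Type $A_1$: for $\sigma\in\{\mathfrak 1,\sigma^e\}$, $$|F^{\sigma}_M(\rho,0)|=|F^{\sigma}_M(0,\rho^\vee)|=|F^{\sigma}_M(\rho,\rho^\vee)|=M.$$ 2. Type $C_2$: $$|F^{\mathfrak 1}_M(\rho,0)|=|F^{\mathfrak 1}_M(0,\rho^\vee)|=|F^{\sigma^s}_M(0,\rho^\vee)|=|F^{\sigma^l}_M(\rho,0)|=\nu_2(M-1),$$ $$|F^{\mathfrak 1}_M(\rho,\rho^\vee)|=|F^{\sigma^e}_M(\rho,\rho^\vee)|=|F^{\sigma^s}_M(\rho,\rho^\vee)|=|F^{\sigma^l}_M(\rho,\rho^\vee)|=\nu_2(M-2),$$ $$|F^{\sigma^e}_M(0,\rho^\vee)|=|F^{\sigma^e}_M(\rho,0)|=|F^{\sigma^s}_M(\rho,0)|=|F^{\sigma^l}_M(0,\rho^\vee)|=\nu_2(M-3).$$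 3. Type $C_n$, $n\ge3$: $$|F^{\mathfrak 1}_M(\rho,0)|=|F^{\sigma^l}_M(\rho,0)|=\nu_n(M-1),\qquad |F^{\sigma^e}_M(\rho,0)|=|F^{\sigma^s}_M(\rho,0)|=\nu_n(M-2n+1).$$ 4. Type $B_n$, $n\ge3$: $$|F^{\mathfrak 1}_M(0,\rho^\vee)|=|F^{\sigma^s}_M(0,\rho^\vee)|=\nu_n(M-1),\qquad |F^{\sigma^e}_M(0,\rho^\vee)|=|F^{\sigma^l}_M(0,\rho^\vee)|=\nu_n(M-2n+1).$$ -/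

import Mathlib

noncomputable section

namespace OrbitGrid

open scoped InnerProductSpace

/-- The orthogonal reflection `x ↦ x - (2⟪v, x⟫/⟪v, v⟫) v` in the hyperplane `v^⊥`
(the identity if `v = 0`). -/
def rootReflection {V : Type*} [NormedAddCommGroup V] [InnerProductSpace ℝ V] (v : V) : V ≃ₗ[ℝ] V :=
  (Submodule.reflection (Submodule.span ℝ {v})ᗮ).toLinearEquiv

/-- The coroot `v^∨ = 2 v / ⟪v, v⟫`. -/
def coroot {V : Type*} [NormedAddCommGroup V] [InnerProductSpace ℝ V] (v : V) : V :=
  (2 / ⟪v, v⟫_ℝ) • v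

/-- The simple roots `α₁, …, αₙ` (a basis of the Euclidean space `V`, indexed by `Fin n`, so that
`αᵢ` is `α (i - 1)`) have the Cartan matrix `C`, i.e. `⟪αᵢ, αⱼ^∨⟫ = C i j`. -/
def HasCartanMatrix {V : Type*} [NormedAddCommGroup V] [InnerProductSpace ℝ V] {n : ℕ}
    (α : Module.Basis (Fin n) ℝ V) (C : Matrix (Fin n) (Fin n) ℤ) : Prop :=
  ∀ i j, ⟪α i, coroot (α j)⟫_ℝ = (C i j : ℝ)

section

variable {V : Type*} [NormedAddCommGroup V] [InnerProductSpace ℝ V] {n : ℕ}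
variable (α : Module.Basis (Fin n) ℝ V)

/-- The Weyl group `W`, generated by the reflections in the simple roots. -/
def weylGroup : Subgroup (V ≃ₗ[ℝ] V) :=
  Subgroup.closure (Set.range fun i => rootReflection (α i))

/-- The root system `Π = W Δ`. -/
def roots : Set V := {β | ∃ w ∈ weylGroup α, ∃ i, β = w (α i)}

/-- The partial order determined by the simple roots: `μ ≤ lam` iff `lam - μ` has nonnegative
coordinates with respect to the simple roots. -/
def RootLE (μ lam : V) : Prop := ∀ i, 0 ≤ α.repr (lam - μ) i

/-- `ξ` is the highest root, the greatest element of `Π`. -/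
def IsHighestRoot (ξ : V) : Prop := ξ ∈ roots α ∧ ∀ β ∈ roots α, RootLE α β ξ

open Classical in
/-- The highest root `ξ` (and `0` if there is none). -/
def highestRoot : V := if h : ∃ ξ, IsHighestRoot α ξ then h.choose else 0

/-- The marks `m₁, …, mₙ`, defined by `ξ = m₁ α₁ + ⋯ + mₙ αₙ`. -/
def mark (i : Fin n) : ℝ := α.repr (highestRoot α) i

/-- The affine reflection `r₀ a = r_ξ a + 2ξ/⟪ξ, ξ⟫`. -/
def affineReflection : V ≃ᵃ[ℝ] V :=
  (rootReflection (highestRoot α)).toAffineEquiv.trans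
    (AffineEquiv.constVAdd ℝ V (coroot (highestRoot α)))

/-- The affine Weyl group, generated by `r₀, r₁, …, rₙ`. -/
def affineWeylGroup : Subgroup (V ≃ᵃ[ℝ] V) :=
  Subgroup.closure
    (insert (affineReflection α) (Set.range fun i => (rootReflection (α i)).toAffineEquiv))

theorem rootReflection_conj (w : V ≃ₗ[ℝ] V) (hw : ∀ x y, ⟪w x, w y⟫_ℝ = ⟪x, y⟫_ℝ) (v : V) :
    rootReflection (w v) = w * rootReflection v * w⁻¹ := by
  have hn : ∀ x, ‖w x‖ = ‖x‖ := fun x => by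
    rw [@norm_eq_sqrt_real_inner V, @norm_eq_sqrt_real_inner V, hw]
  ext x
  obtain ⟨y, rfl⟩ := w.surjective x
  have h2 : (w⁻¹ : V ≃ₗ[ℝ] V) (w y) = y := w.symm_apply_apply y
  simp only [LinearEquiv.mul_apply, h2]
  simp [rootReflection, Submodule.reflection_orthogonal_apply, Submodule.reflection_singleton_apply, hw, hn]

theorem weylGroup_inner {w : V ≃ₗ[ℝ] V} (hw : w ∈ weylGroup α) :
    ∀ x y, ⟪w x, w y⟫_ℝ = ⟪x, y⟫_ℝ := by
  induction hw using Subgroup.closure_induction with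
  | mem w h => obtain ⟨i, rfl⟩ := h; intro x y; exact LinearIsometryEquiv.inner_map_map _ x y
  | one => intro x y; rfl
  | mul a b _ _ ha hb => intro x y; simp only [LinearEquiv.mul_apply, ha, hb]
  | inv a _ ha =>
    intro x y
    have h : ∀ z, a ((a⁻¹ : V ≃ₗ[ℝ] V) z) = z := fun z => a.apply_symm_apply z
    rw [← ha, h, h]

theorem rootReflection_highestRoot_mem : rootReflection (highestRoot α) ∈ weylGroup α := by
  unfold highestRoot
  split_ifs with h
  · obtain ⟨w, hw, i, hi⟩ := h.choose_spec.1
    rw [hi, rootReflection_conj w (weylGroup_inner α hw)]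
    exact mul_mem (mul_mem hw (Subgroup.subset_closure ⟨i, rfl⟩)) (inv_mem hw)
  · have : rootReflection (0 : V) = 1 := by
      ext x
      exact Submodule.reflection_mem_subspace_eq_self (by simp)
    rw [this]
    exact one_mem _

theorem linear_mem_weylGroup {f : V ≃ᵃ[ℝ] V} (hf : f ∈ affineWeylGroup α) :
    f.linear ∈ weylGroup α := by
  have : affineWeylGroup α ≤ (weylGroup α).comap AffineEquiv.linearHom := by
    refine (Subgroup.closure_le _).2 ?_
    rintro g (rfl | ⟨i, rfl⟩)
    · exact rootReflection_highestRoot_mem α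
    · exact Subgroup.subset_closure ⟨i, rfl⟩
  exact this hf

/-- The retraction homomorphism `ψ`, sending `a ↦ w a + q` to `w`. -/
def retraction : affineWeylGroup α →* weylGroup α :=
  (AffineEquiv.linearHom.comp (affineWeylGroup α).subtype).codRestrict (weylGroup α)
    fun f => linear_mem_weylGroup α f.2

/-- The translation part `τ`, sending `a ↦ w a + q` to `q`. -/
def translationPart (f : affineWeylGroup α) : V := f.1 0

/-- A simple root is long if no simple root is longer. -/
def IsLong (i : Fin n) : Prop := ∀ j, ‖α j‖ ≤ ‖α i‖

end

/-- The names of the four sign homomorphisms `1`, `σ^e`, `σ^s`, `σ^l`. -/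
inductive SignKind
  | one
  | e
  | s
  | l

section

variable {V : Type*} [NormedAddCommGroup V] [InnerProductSpace ℝ V] {n : ℕ}
variable (α : Module.Basis (Fin n) ℝ V)

open Classical in
/-- The value of a sign homomorphism on the reflection in the `i`-th simple root. -/
def signValue : SignKind → Fin n → ℤˣ
  | .one, _ => 1
  | .e, _ => -1
  | .s, i => if IsLong α i then 1 else -1
  | .l, i => if IsLong α i then -1 else 1

open Classical in
/-- The sign homomorphism `σ : W → {±1}`: the homomorphism with the prescribed values on the
reflections in the simple roots (unique, since these generate `W`). -/
def signHom (σ : SignKind) : weylGroup α →* ℤˣ :=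
  if h : ∃ χ : weylGroup α →* ℤˣ, ∀ i,
      χ ⟨rootReflection (α i), Subgroup.subset_closure ⟨i, rfl⟩⟩ = signValue α σ i
  then h.choose else 1

/-- The dual weight lattice `P^∨`, the `ℤ`-dual of the root lattice. -/
def dualWeightLattice : Set V := {v | ∀ i, ∃ k : ℤ, ⟪v, α i⟫_ℝ = k}

/-- The weight lattice `P`, the `ℤ`-dual of the dual root lattice. -/
def weightLattice : Set V := {v | ∀ i, ∃ k : ℤ, ⟪v, coroot (α i)⟫_ℝ = k}

/-- `ρ` is a nontrivial admissible shift of the lattice `L`: the shifted lattice `ρ + L` is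
`W`-invariant, and `ρ ∉ L`. -/
def IsNontrivialShift (L : Set V) (ρ : V) : Prop :=
  (∀ w ∈ weylGroup α, w '' ((ρ + ·) '' L) = (ρ + ·) '' L) ∧ ρ ∉ L

/-- `ρ^∨` is a nontrivial admissible shift. -/
def IsNontrivialAdmissibleShift (ρc : V) : Prop := IsNontrivialShift α (dualWeightLattice α) ρc

/-- `ρ` is a nontrivial admissible dual shift. -/
def IsNontrivialAdmissibleDualShift (ρ : V) : Prop := IsNontrivialShift α (weightLattice α) ρ

/-- The dual shift homomorphism `θ_ρ(f) = exp(2πi ⟪τ(f), ρ⟫)`. -/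
def theta (ρ : V) (f : affineWeylGroup α) : ℂ :=
  Complex.exp (2 * Real.pi * Complex.I * (⟪translationPart α f, ρ⟫_ℝ : ℝ))

/-- The homomorphism `γ^σ_ρ = θ_ρ · (σ ∘ ψ)`. -/
def gamma (σ : SignKind) (ρ : V) (f : affineWeylGroup α) : ℂ :=
  theta α ρ f * ((signHom α σ (retraction α f) : ℤ) : ℂ)

/-- The fundamental domain `F`: the points `y₁ ω₁^∨ + ⋯ + yₙ ωₙ^∨` with `y₀, …, yₙ ≥ 0` and
`y₀ + m₁ y₁ + ⋯ + mₙ yₙ = 1`. As `⟪αᵢ, ωⱼ^∨⟫ = δᵢⱼ`, the coordinates of `a` are `yᵢ = ⟪αᵢ, a⟫`. -/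
def fundamentalDomain : Set V :=
  {a | (∀ i, 0 ≤ ⟪α i, a⟫_ℝ) ∧ ∃ y₀ : ℝ, 0 ≤ y₀ ∧ y₀ + ∑ i, mark α i * ⟪α i, a⟫_ℝ = 1}

/-- `F^σ(ρ)`: the points of `F` on whose stabilizer in the affine Weyl group `γ^σ_ρ` is trivial. -/
def signedDomain (σ : SignKind) (ρ : V) : Set V :=
  {a | a ∈ fundamentalDomain α ∧ ∀ f : affineWeylGroup α, f.1 a = a → gamma α σ ρ f = 1}

/-- The grid `F^σ_M(ρ, ρ^∨) = (1/M)(ρ^∨ + P^∨) ∩ F^σ(ρ)`. -/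
def grid (σ : SignKind) (M : ℕ) (ρ ρc : V) : Set V :=
  {a | ∃ p ∈ dualWeightLattice α, a = (1 / (M : ℝ)) • (ρc + p)} ∩ signedDomain α σ ρ

end

/-- `ν_n(2k) = C(n+k, n) + C(n+k-1, n)` and `ν_n(2k+1) = 2 C(n+k, n)`, for integers `k ≥ 1 - n`. -/
def nu (n : ℕ) (m : ℤ) : ℕ :=
  if Even m then (n + m / 2).toNat.choose n + (n + m / 2 - 1).toNat.choose n
  else 2 * (n + m / 2).toNat.choose n

end OrbitGrid

end

open OrbitGrid

open scoped InnerProductSpace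

namespace OrbitGrid

/-! Put `n = m + 1`. The Cartan matrix yields an orthogonal frame `e 0, …, e m` of common squared
norm `c` in which the simple roots are `e i - e (i+1)` and, last, `κ e m`, with `κ = 2` for type C
(and A₁ = C₁) and `κ = 1` for type B. In the coordinates `xᵢ = ⟪e i, a⟫` the affine Weyl group acts
by signed permutations `(π, ε)` followed by integral translations `q`. Let `a` be the value of `σ`
on the first `m` simple reflections and `b` its value on the last. Then `γ` is explicit: it is `t ^
∑ q`, times `sign π` if `a = -1`, times `∏ ε` if `b = -1`. Here `t = 1` for `ρ = 0`, and `t = -1`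
for a nontrivial dual shift in type C.

Type C. The domain is `1/2 ≥ x₀ ≥ … ≥ xₘ ≥ 0`, and the signed domain omits exactly the walls whose
reflection has `γ = -1`: `a = -1` makes the chain strict, `b = -1` forbids `0`, `b t = -1` forbids
`1/2` (`mem_signedDomain_C`). Scaling by `2M` turns the unshifted grid into integer tuples in `[0,
M]` of constant parity. If `t = -1`, exactly one endpoint is forbidden, which leaves `M` consecutive
integers. Strictly decreasing tuples of one parity are subsets of a parity class, which gives the
two binomials of `nu`; weakly decreasing ones become strict after adding a staircase of step 2. A
nontrivial `ρ^∨` gives pairs of opposite parity for C₂, and odd numbers after scaling by `4M` for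
A₁.

Type B. A nontrivial `ρ^∨` makes every `2M xᵢ` odd. The walls `xᵢ = 0` are then missed, and `σ`
matters only through `a` (`mem_signedDomain_B`). The remaining region `u₀ + u₁ ≤ 2M` is folded by
`u₀ ↦ 2M - u₀` into decreasing odd tuples in `[1, M]` and in `[1, M-1]` (`encard_reflected`), with
the same counts as before. -/

/-! ### Counting decreasing integer tuples -/

theorem encard_strictAnti (n : ℕ) (A : Finset ℤ) :
    {u : Fin n → ℤ | StrictAnti u ∧ ∀ i, u i ∈ A}.encard = (A.card.choose n : ℕ) := by
  have h : (fun u : Fin n → ℤ => Finset.univ.image u) ''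
      {u : Fin n → ℤ | StrictAnti u ∧ ∀ i, u i ∈ A} = (A.powersetCard n : Set (Finset ℤ)) := by
    ext s
    rw [Finset.mem_coe, Finset.mem_powersetCard]
    simp only [Set.mem_image, Set.mem_ofPred_eq]
    constructor
    · rintro ⟨u, ⟨hu, hA⟩, rfl⟩
      refine ⟨?_, ?_⟩
      · intro t ht
        obtain ⟨i, -, rfl⟩ := Finset.mem_image.1 ht
        exact hA i
      · rw [Finset.card_image_of_injective _ hu.injective, Finset.card_univ, Fintype.card_fin]
    · rintro ⟨hs, hc⟩
      -- The increasing enumeration of `s`, read backwards.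
      refine ⟨fun i => s.orderEmbOfFin hc i.rev, ⟨?_, ?_⟩, ?_⟩
      · intro i j hij
        exact (s.orderEmbOfFin hc).strictMono (Fin.rev_lt_rev.2 hij)
      · intro i
        exact hs (Finset.orderEmbOfFin_mem _ _ _)
      · ext t
        have := Finset.range_orderEmbOfFin s hc
        rw [Set.ext_iff] at this
        have := this t
        simp only [Set.mem_range, Finset.mem_coe] at this
        simp only [Finset.mem_image, Finset.mem_univ, true_and, ← this]
        constructor
        · rintro ⟨i, rfl⟩; exact ⟨_, rfl⟩
        · rintro ⟨i, rfl⟩; exact ⟨i.rev, by simp⟩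
  have hinj : Set.InjOn (fun u : Fin n → ℤ => Finset.univ.image u)
      {u : Fin n → ℤ | StrictAnti u ∧ ∀ i, u i ∈ A} := by
    rintro u ⟨hu, -⟩ v ⟨hv, -⟩ h
    have h1 : Set.range u = Set.range v := by
      have := congrArg (fun s : Finset ℤ => (s : Set ℤ)) h
      simpa using this
    have h2 := StrictMono.range_inj (f := u ∘ Fin.rev) (g := v ∘ Fin.rev)
      (fun i j hij => hu (Fin.rev_lt_rev.2 hij)) (fun i j hij => hv (Fin.rev_lt_rev.2 hij))
    rw [Fin.rev_surjective.range_comp, Fin.rev_surjective.range_comp] at h2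
    funext i
    have := congrFun (h2.1 h1) i.rev
    simpa using this
  rw [← hinj.encard_image, h, Set.encard_coe_eq_coe_finsetCard, Finset.card_powersetCard]

theorem card_filter_mod_Ico (a M : ℕ) (r : ℕ) (hr : r < 2) :
    ((Finset.Ico (a : ℤ) (a + M)).filter (fun t : ℤ => t % 2 = (r : ℤ))).card
      = if a % 2 = r then (M + 1) / 2 else M / 2 := by
  induction M with
  | zero => simp
  | succ M ih =>
    have : Finset.Ico (a : ℤ) (a + (M + 1 : ℕ)) = insert (a + M : ℤ) (Finset.Ico (a : ℤ) (a + M)) := by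
      ext t; simp only [Finset.mem_Ico, Finset.mem_insert]; push_cast; omega
    rw [this, Finset.filter_insert]
    split_ifs at ih ⊢ with h1 h2
    all_goals first
      | rw [Finset.card_insert_of_notMem (by simp), ih]; omega
      | rw [ih]; omega

theorem encard_strictAnti_mod (n a M r : ℕ) (hr : r < 2) :
    {u : Fin n → ℤ | StrictAnti u ∧ ∀ i, (a ≤ u i ∧ u i < a + M) ∧ u i % 2 = r}.encard
      = ((if a % 2 = r then (M + 1) / 2 else M / 2).choose n : ℕ) := by
  rw [← card_filter_mod_Ico a M r hr, ← encard_strictAnti]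
  congr 1
  ext u
  simp

/-- Adding the staircase `2(m - i)` keeps parities, makes a weakly decreasing tuple strictly
decreasing and lengthens the interval by `2m`; this reduces the count to the strict one. -/
theorem encard_antitone_mod (m a M r : ℕ) (hr : r < 2) :
    {u : Fin (m + 1) → ℤ | Antitone u ∧ ∀ i, (a ≤ u i ∧ u i < a + M) ∧ u i % 2 = r}.encard
      = ((if a % 2 = r then (M + 2 * m + 1) / 2 else (M + 2 * m) / 2).choose (m + 1) : ℕ) := by
  rw [← encard_strictAnti_mod (m + 1) a (M + 2 * m) r hr]
  let s : Fin (m + 1) → ℤ := fun i => 2 * ((m : ℤ) - i)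
  rw [← (add_right_injective s).encard_image]
  congr 1
  ext v
  simp only [Set.mem_image, Set.mem_ofPred_eq]
  constructor
  · rintro ⟨u, ⟨hu, hJ⟩, rfl⟩
    refine ⟨?_, fun i => ?_⟩
    · intro i j hij
      have := hu hij.le
      have h2 : (i : ℕ) < j := hij
      simp only [Pi.add_apply, s]; omega
    · have := hJ i
      simp only [Pi.add_apply, s]; omega
  · rintro ⟨hv, hJ⟩
    -- Strictly decreasing neighbours of equal parity differ by at least 2, the step of the
    -- staircase.
    have hanti : Antitone (v - s) := by
      rw [Fin.antitone_iff_succ_le]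
      intro i
      have h1 := hv i.castSucc_lt_succ
      have h2 := hJ i.castSucc
      have h3 := hJ i.succ
      simp only [Pi.sub_apply, s, Fin.val_succ, Fin.val_castSucc]; omega
    refine ⟨v - s, ⟨hanti, fun i => ?_⟩, by simp⟩
    -- By monotonicity only the first and last entries need bounds; the staircase is `2m` at the
    -- first and `0` at the last.
    have h1 := hanti (Fin.zero_le i)
    have h2 := hanti (Fin.le_last i)
    have h3 := hJ 0
    have h4 := hJ (Fin.last m)
    have h5 := hJ i
    simp only [Pi.sub_apply, s, Fin.val_zero, Fin.val_last] at *
    omega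

theorem encard_parity_split {m a : ℕ} {M b c d : ℕ} (P : (Fin (m + 1) → ℤ) → Prop)
    (h : ∀ r : ℕ, r < 2 → {u : Fin (m + 1) → ℤ | P u ∧
      ∀ i, (a ≤ u i ∧ u i < a + M) ∧ u i % 2 = (r : ℤ)}.encard
      = ((if a % 2 = r then b else c).choose d : ℕ)) :
    {u : Fin (m + 1) → ℤ | P u ∧ (∀ i, a ≤ u i ∧ u i < a + M) ∧
      ∀ i j, u i % 2 = u j % 2}.encard = (b.choose d + c.choose d : ℕ) := by
  have h0 := h 0 (by norm_num)
  have h1 := h 1 (by norm_num)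
  have hu : {u : Fin (m + 1) → ℤ | P u ∧ (∀ i, a ≤ u i ∧ u i < a + M) ∧
      ∀ i j, u i % 2 = u j % 2} =
      {u : Fin (m + 1) → ℤ | P u ∧ ∀ i, (a ≤ u i ∧ u i < a + M) ∧ u i % 2 = ((0 : ℕ) : ℤ)} ∪
      {u : Fin (m + 1) → ℤ | P u ∧ ∀ i, (a ≤ u i ∧ u i < a + M) ∧ u i % 2 = ((1 : ℕ) : ℤ)} := by
    ext u
    simp only [Set.mem_ofPred_eq, Set.mem_union]
    constructor
    · rintro ⟨h, hJ, hp⟩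
      rcases Int.emod_two_eq_zero_or_one (u 0) with h' | h'
      · exact Or.inl ⟨h, fun i => ⟨hJ i, by rw [hp i 0, h']; rfl⟩⟩
      · exact Or.inr ⟨h, fun i => ⟨hJ i, by rw [hp i 0, h']; rfl⟩⟩
    · rintro (⟨h, hJ⟩ | ⟨h, hJ⟩)
      · exact ⟨h, fun i => (hJ i).1, fun i j => by rw [(hJ i).2, (hJ j).2]⟩
      · exact ⟨h, fun i => (hJ i).1, fun i j => by rw [(hJ i).2, (hJ j).2]⟩
  rw [hu, Set.encard_union_eq, h0, h1, ← Nat.cast_add]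
  · congr 1
    -- The parity of the left end only decides which of the two classes is the larger one.
    rcases Nat.mod_two_eq_zero_or_one a with h | h <;> simp [h, add_comm]
  · rw [Set.disjoint_left]
    rintro u ⟨-, h⟩ ⟨-, h'⟩
    have := (h 0).2; have := (h' 0).2; omega

theorem encard_strictAnti_parity (m a M : ℕ) :
    {u : Fin (m + 1) → ℤ | StrictAnti u ∧ (∀ i, a ≤ u i ∧ u i < a + M) ∧
      ∀ i j, u i % 2 = u j % 2}.encard
      = (((M + 1) / 2).choose (m + 1) + (M / 2).choose (m + 1) : ℕ) :=
  encard_parity_split _ fun r hr => encard_strictAnti_mod (m + 1) a M r hr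

theorem encard_antitone_parity (m a M : ℕ) :
    {u : Fin (m + 1) → ℤ | Antitone u ∧ (∀ i, a ≤ u i ∧ u i < a + M) ∧
      ∀ i j, u i % 2 = u j % 2}.encard
      = (((M + 2 * m + 1) / 2).choose (m + 1) + ((M + 2 * m) / 2).choose (m + 1) : ℕ) :=
  encard_parity_split _ fun r hr => encard_antitone_mod m a M r hr

/-- The right side is the strict count: `(M + 1) / 2` and `M / 2` are the sizes of the two parity
classes among `M` consecutive integers. -/
theorem nu_strict (n M : ℕ) (hM : 0 < M) :
    nu n (M - 2 * n + 1) = ((M + 1) / 2).choose n + (M / 2).choose n := by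
  unfold nu
  rcases Nat.even_or_odd' M with ⟨k, rfl | rfl⟩
  · rw [if_neg (by rw [Int.even_iff]; push_cast; omega)]
    have h1 : ((n : ℤ) + (((2 * k : ℕ) : ℤ) - 2 * n + 1) / 2).toNat = k := by push_cast; omega
    rw [h1, show (2 * k + 1) / 2 = k by omega, show 2 * k / 2 = k by omega, two_mul]
  · rw [if_pos (by rw [Int.even_iff]; push_cast; omega)]
    have h1 : ((n : ℤ) + (((2 * k + 1 : ℕ) : ℤ) - 2 * n + 1) / 2).toNat = k + 1 := by push_cast; omega
    have h2 : ((n : ℤ) + (((2 * k + 1 : ℕ) : ℤ) - 2 * n + 1) / 2 - 1).toNat = k := by push_cast; omega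
    rw [h1, h2, show (2 * k + 1 + 1) / 2 = k + 1 by omega, show (2 * k + 1) / 2 = k by omega]

/-- The staircase replaces `M` by `M + 2m`, and `(M + 2m) - 2(m + 1) + 1 = M - 1`. -/
theorem nu_weak (m M : ℕ) (hM : 0 < M) :
    nu (m + 1) (M - 1) = ((M + 2 * m + 1) / 2).choose (m + 1) + ((M + 2 * m) / 2).choose (m + 1) := by
  rw [← nu_strict (m + 1) (M + 2 * m) (by omega)]
  congr 1
  push_cast
  ring

/-- Pairs of different parity in an interval. -/
theorem encard_pair_mixed (a M : ℕ) :
    {u : Fin 2 → ℤ | Antitone u ∧ (∀ i, a ≤ u i ∧ u i < a + M) ∧ (u 0 + u 1) % 2 = 1}.encard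
      = (((M + 1) / 2) * (M / 2) : ℕ) := by
  have hc : ((((Finset.Ico (a : ℤ) (a + M)).filter (fun t : ℤ => t % 2 = ((0 : ℕ) : ℤ))) ×ˢ
      ((Finset.Ico (a : ℤ) (a + M)).filter (fun t : ℤ => t % 2 = ((1 : ℕ) : ℤ)))).card)
      = ((M + 1) / 2) * (M / 2) := by
    rw [Finset.card_product, card_filter_mod_Ico a M 0 (by norm_num),
      card_filter_mod_Ico a M 1 (by norm_num)]
    rcases Nat.mod_two_eq_zero_or_one a with h | h <;> simp [h, mul_comm]
  rw [← hc, ← Set.encard_coe_eq_coe_finsetCard]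
  symm
  -- A decreasing pair of mixed parity is determined by its even and its odd entry, which can be
  -- chosen independently and then sorted.
  refine Set.encard_congr ⟨fun p => ⟨![max p.1.1 p.1.2, min p.1.1 p.1.2], ?_⟩,
    fun u => ⟨if u.1 0 % 2 = 0 then (u.1 0, u.1 1) else (u.1 1, u.1 0), ?_⟩, ?_, ?_⟩
  · obtain ⟨⟨x, y⟩, h⟩ := p
    simp at h
    refine ⟨?_, ?_, ?_⟩
    · rw [Fin.antitone_iff_succ_le]; intro i; fin_cases i; simp
    · intro i; fin_cases i <;> simp <;> omega
    · simp; omega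
  · obtain ⟨u, h1, h2, h3⟩ := u
    have := h2 0; have := h2 1
    split_ifs with h <;> simp at h ⊢ <;> omega
  · rintro ⟨⟨x, y⟩, h⟩
    simp at h
    ext <;> simp <;> split_ifs <;> simp <;> omega
  · rintro ⟨u, h1, h2, h3⟩
    have := h1 (show (0 : Fin 2) ≤ 1 by decide)
    ext i
    fin_cases i <;> simp <;> split_ifs <;> simp <;> omega

/-! ### Orthogonal frames and signed permutations -/

section Frame

variable {V : Type*} [NormedAddCommGroup V] [InnerProductSpace ℝ V] {m : ℕ}

/-- Orthogonal vectors `e₀, …, eₘ` of squared norm `c` with `αᵢ = eᵢ - eᵢ₊₁` for `i < m` and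
`αₘ = κ eₘ`. -/
structure IsFrame (α : Module.Basis (Fin (m + 1)) ℝ V) (e : Fin (m + 1) → V) (κ c : ℝ) : Prop where
  pos : 0 < c
  scale_pos : 0 < κ
  orth : ∀ i j, ⟪e i, e j⟫_ℝ = if i = j then c else 0
  simple : ∀ i : Fin m, α i.castSucc = e i.castSucc - e i.succ
  last : α (Fin.last m) = κ • e (Fin.last m)

theorem exists_isFrame_of_gram (α : Module.Basis (Fin (m + 1)) ℝ V) {κ c : ℝ} (hc : 0 < c)
    (hκ : 0 < κ)
    (h1 : ∀ i k : Fin m, ⟪α i.castSucc, α k.castSucc⟫_ℝ =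
      if i = k then 2 * c else if (i : ℕ) + 1 = k ∨ (k : ℕ) + 1 = i then -c else 0)
    (h2 : ∀ i : Fin m, ⟪α i.castSucc, α (Fin.last m)⟫_ℝ = if (i : ℕ) + 1 = m then -(κ * c) else 0)
    (h3 : ⟪α (Fin.last m), α (Fin.last m)⟫_ℝ = κ ^ 2 * c) :
    ∃ e, IsFrame α e κ c := by
  -- The frame is forced by the required form of the simple roots, solved from the last one
  -- downwards.
  let e : Fin (m + 1) → V := Fin.reverseInduction (κ⁻¹ • α (Fin.last m))
    (fun i v => α i.castSucc + v)
  have el : e (Fin.last m) = κ⁻¹ • α (Fin.last m) := Fin.reverseInduction_last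
  have es : ∀ i : Fin m, e i.castSucc = α i.castSucc + e i.succ :=
    fun i => Fin.reverseInduction_castSucc i
  have hs : ∀ i : Fin m, α i.castSucc = e i.castSucc - e i.succ := fun i => by rw [es]; abel
  have hl : α (Fin.last m) = κ • e (Fin.last m) := by rw [el, smul_inv_smul₀ hκ.ne']
  -- Orthogonality is reached in two downward inductions: first the frame against the simple roots,
  -- then the frame against itself.
  have k1 : ∀ i (k : Fin m), ⟪e i, α k.castSucc⟫_ℝ =
      (if i = k.castSucc then c else 0) - (if i = k.succ then c else 0) := by
    intro i k
    induction i using Fin.reverseInduction with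
    | last =>
      rw [el, inner_smul_left, real_inner_comm, h2]
      simp only [Fin.ext_iff, Fin.val_last, Fin.val_castSucc, Fin.val_succ, map_inv₀, conj_trivial]
      have := k.2
      rw [if_neg (show ¬ m = (k : ℕ) by omega)]
      by_cases h : (k : ℕ) + 1 = m
      · rw [if_pos h, if_pos h.symm]; field_simp; ring
      · rw [if_neg h, if_neg (Ne.symm h)]; ring
    | cast i ih =>
      rw [es, inner_add_left, ih, h1]
      simp only [Fin.ext_iff, Fin.val_castSucc, Fin.val_succ]
      split_ifs <;> first | omega | ring
  have k2 : ∀ i, ⟪e i, α (Fin.last m)⟫_ℝ = if i = Fin.last m then κ * c else 0 := by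
    intro i
    induction i using Fin.reverseInduction with
    | last => rw [el, inner_smul_left, h3]; simp; field_simp
    | cast i ih =>
      rw [es, inner_add_left, ih, h2]
      have := i.2
      simp only [Fin.ext_iff, Fin.val_castSucc, Fin.val_succ, Fin.val_last]
      split_ifs <;> first | omega | ring
  refine ⟨e, hc, hκ, ?_, hs, hl⟩
  intro i j
  induction j using Fin.reverseInduction with
  | last => rw [el, inner_smul_right, k2]; split_ifs <;> field_simp; simp
  | cast j ih => rw [es, inner_add_right, ih, k1]; split_ifs <;> ring

theorem inner_eq_of_hasCartanMatrix {n : ℕ} {α : Module.Basis (Fin n) ℝ V}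
    {C : Matrix (Fin n) (Fin n) ℤ} (h : HasCartanMatrix α C) (i j : Fin n) :
    ⟪α i, α j⟫_ℝ = C i j * ⟪α j, α j⟫_ℝ / 2 := by
  have hj : ⟪α j, α j⟫_ℝ ≠ 0 := inner_self_ne_zero.2 (α.ne_zero j)
  have := h i j
  rw [coroot, inner_smul_right] at this
  rw [← this]; field_simp

/-- The Cartan integers fix ratios of squared lengths along the connected diagram, so the Gram
matrix is known up to the single scale `c`. -/
theorem exists_isFrame_of_cartan (α : Module.Basis (Fin (m + 1)) ℝ V)
    {C : Matrix (Fin (m + 1)) (Fin (m + 1)) ℤ} (h : HasCartanMatrix α C) {κ : ℝ} (hκ : 0 < κ)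
    (hd : ∀ i, C i i = 2)
    (hC : ∀ i k : Fin m, i ≠ k → C i.castSucc k.castSucc =
      if (i : ℕ) + 1 = k ∨ (k : ℕ) + 1 = i then -1 else 0)
    (hl : ∀ i : Fin m, (C i.castSucc (Fin.last m) : ℝ) =
      if (i : ℕ) + 1 = m then -(2 / κ) else 0)
    (hl' : ∀ i : Fin m, (C (Fin.last m) i.castSucc : ℝ) = if (i : ℕ) + 1 = m then -κ else 0) :
    ∃ e c, IsFrame α e κ c := by
  have hg := inner_eq_of_hasCartanMatrix h
  have hsymm : ∀ i j, (C i j : ℝ) * ⟪α j, α j⟫_ℝ = C j i * ⟪α i, α i⟫_ℝ := by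
    intro i j
    have h1 := hg i j
    have h2 := hg j i
    rw [real_inner_comm] at h2
    linarith
  have hpos : 0 < ⟪α (Fin.last m), α (Fin.last m)⟫_ℝ := real_inner_self_pos.2 (α.ne_zero _)
  obtain ⟨c, hc, hN⟩ : ∃ c : ℝ, 0 < c ∧ ⟪α (Fin.last m), α (Fin.last m)⟫_ℝ = κ ^ 2 * c :=
    ⟨⟪α (Fin.last m), α (Fin.last m)⟫_ℝ / κ ^ 2, by positivity, by field_simp⟩
  -- The symmetry `hsymm` carries the length from each node of the diagram to the preceding one,
  -- starting at the last.
  have hN' : ∀ i : Fin (m + 1), i ≠ Fin.last m → ⟪α i, α i⟫_ℝ = 2 * c := by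
    intro i
    induction i using Fin.reverseInduction with
    | last => intro h; exact absurd rfl h
    | cast i ih =>
      intro _
      by_cases hi : (i : ℕ) + 1 = m
      · have := hsymm i.castSucc (Fin.last m)
        rw [hl, hl', if_pos hi, if_pos hi, hN] at this
        field_simp at this
        nlinarith
      · have hi' : i.succ ≠ Fin.last m := by
          rw [Ne, Fin.ext_iff]; simpa using hi
        obtain ⟨k, hk⟩ := Fin.exists_castSucc_eq.2 hi'
        have hv : (k : ℕ) = i + 1 := by
          have := congrArg Fin.val hk
          simpa using this
        rw [← ih hi', ← hk]
        have := hsymm i.castSucc k.castSucc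
        rw [hC i k (by rintro rfl; omega), hC k i (by rintro rfl; omega), if_pos (by omega),
          if_pos (by omega)] at this
        push_cast at this
        linarith
  refine (exists_isFrame_of_gram α hc hκ ?_ ?_ ?_).imp fun e he => ⟨c, he⟩
  · intro i k
    rw [hg, hN' _ (Fin.castSucc_lt_last k).ne]
    by_cases hik : i = k
    · subst hik; rw [hd, if_pos rfl]; push_cast; ring
    · rw [if_neg hik, hC i k hik]; split_ifs <;> push_cast <;> ring
  · intro i
    rw [hg, hN, hl]
    split_ifs
    · field_simp
    · ring
  · exact hN

theorem exists_isFrame_C (α : Module.Basis (Fin (m + 1)) ℝ V)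
    (h : HasCartanMatrix α (CartanMatrix.C (m + 1))) : ∃ e c, IsFrame α e 2 c := by
  refine exists_isFrame_of_cartan α h two_pos (by simp) ?_ ?_ ?_
  · intro i k hik
    have := k.2; have := i.2
    simp only [CartanMatrix.C, Matrix.of_apply, Fin.ext_iff, Fin.val_castSucc] at hik ⊢
    split_ifs <;> omega
  · intro i
    have := i.2
    simp only [CartanMatrix.C, Matrix.of_apply, Fin.ext_iff, Fin.val_castSucc, Fin.val_last]
    split_ifs <;> first | omega | norm_num
  · intro i
    have := i.2
    simp only [CartanMatrix.C, Matrix.of_apply, Fin.ext_iff, Fin.val_castSucc, Fin.val_last]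
    split_ifs <;> first | omega | norm_num

theorem exists_isFrame_B (α : Module.Basis (Fin (m + 1)) ℝ V)
    (h : HasCartanMatrix α (CartanMatrix.B (m + 1))) : ∃ e c, IsFrame α e 1 c := by
  refine exists_isFrame_of_cartan α h one_pos (by simp) ?_ ?_ ?_
  · intro i k hik
    have := k.2; have := i.2
    simp only [CartanMatrix.B, Matrix.of_apply, Fin.ext_iff, Fin.val_castSucc] at hik ⊢
    split_ifs <;> omega
  · intro i
    have := i.2
    simp only [CartanMatrix.B, Matrix.of_apply, Fin.ext_iff, Fin.val_castSucc, Fin.val_last]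
    split_ifs <;> first | omega | norm_num
  · intro i
    have := i.2
    simp only [CartanMatrix.B, Matrix.of_apply, Fin.ext_iff, Fin.val_castSucc, Fin.val_last]
    split_ifs <;> first | omega | norm_num

namespace IsFrame

variable {α : Module.Basis (Fin (m + 1)) ℝ V} {e : Fin (m + 1) → V} {κ c : ℝ}

theorem ext_inner (h : IsFrame α e κ c) {a b : V} (hab : ∀ i, ⟪e i, a⟫_ℝ = ⟪e i, b⟫_ℝ) : a = b := by
  refine InnerProductSpace.ext_inner_left_basis α fun j => ?_
  induction j using Fin.lastCases with
  | last => rw [h.last, inner_smul_left, inner_smul_left, hab]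
  | cast j => rw [h.simple, inner_sub_left, inner_sub_left, hab, hab]

theorem inner_sum (h : IsFrame α e κ c) (x : Fin (m + 1) → ℝ) (i : Fin (m + 1)) :
    ⟪e i, ∑ j, x j • e j⟫_ℝ = c * x i := by
  simp [_root_.inner_sum, inner_smul_right, h.orth, mul_comm]

theorem exists_coords (h : IsFrame α e κ c) (x : Fin (m + 1) → ℝ) : ∃ a, ∀ i, ⟪e i, a⟫_ℝ = x i := by
  refine ⟨∑ j, (x j / c) • e j, fun i => ?_⟩
  rw [h.inner_sum]
  have := h.pos
  field_simp

theorem sum_eq (h : IsFrame α e κ c) (a : V) : ∑ j, (⟪e j, a⟫_ℝ / c) • e j = a := by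
  refine h.ext_inner fun i => ?_
  rw [h.inner_sum]
  have := h.pos
  field_simp

theorem inner_eq (h : IsFrame α e κ c) (a b : V) :
    ⟪a, b⟫_ℝ = ∑ j, ⟪e j, a⟫_ℝ * (⟪e j, b⟫_ℝ / c) := by
  conv_lhs => rw [← h.sum_eq b]
  rw [_root_.inner_sum]
  refine Finset.sum_congr rfl fun j _ => ?_
  rw [inner_smul_right, real_inner_comm a, mul_comm]

theorem ne_zero (h : IsFrame α e κ c) (i : Fin (m + 1)) : e i ≠ 0 := by
  intro h0
  have := h.orth i i
  rw [h0, inner_zero_left, if_pos rfl] at this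
  exact h.pos.ne this

theorem norm_simple (h : IsFrame α e κ c) (i : Fin m) : ‖α i.castSucc‖ ^ 2 = 2 * c := by
  rw [← real_inner_self_eq_norm_sq, h.simple]
  simp only [inner_sub_left, inner_sub_right, h.orth, if_true]
  rw [if_neg i.castSucc_lt_succ.ne, if_neg i.castSucc_lt_succ.ne']
  ring

theorem norm_last (h : IsFrame α e κ c) : ‖α (Fin.last m)‖ ^ 2 = κ ^ 2 * c := by
  rw [← real_inner_self_eq_norm_sq, h.last, inner_smul_left, inner_smul_right, h.orth, if_pos rfl]
  simp; ring

end IsFrame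

/-- `w` maps `e i` to `ε i • e (π i)`. -/
def IsSigned (e : Fin (m + 1) → V) (w : V ≃ₗ[ℝ] V) (π : Equiv.Perm (Fin (m + 1)))
    (ε : Fin (m + 1) → ℤˣ) : Prop :=
  ∀ i, w (e i) = (((ε i : ℤˣ) : ℤ) : ℝ) • e (π i)

theorem unit_sq_real (u : ℤˣ) : (((u : ℤˣ) : ℤ) : ℝ) * ((u : ℤ) : ℝ) = 1 := by
  rcases Int.units_eq_one_or u with rfl | rfl <;> simp

namespace IsSigned

variable {e : Fin (m + 1) → V} {w w' : V ≃ₗ[ℝ] V} {π π' : Equiv.Perm (Fin (m + 1))}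
  {ε ε' : Fin (m + 1) → ℤˣ}

theorem one : IsSigned e 1 1 1 := fun i => by simp

theorem mul (h : IsSigned e w π ε) (h' : IsSigned e w' π' ε') :
    IsSigned e (w * w') (π * π') (fun i => ε' i * ε (π' i)) := fun i => by
  rw [LinearEquiv.mul_apply, h', map_smul, h, smul_smul, Equiv.Perm.mul_apply]
  push_cast; rfl

theorem inv (h : IsSigned e w π ε) : IsSigned e w⁻¹ π⁻¹ (fun i => ε (π⁻¹ i)) := fun i => by
  apply w.injective
  rw [map_smul, h, smul_smul, unit_sq_real, one_smul]
  have : w ((w⁻¹ : V ≃ₗ[ℝ] V) (e i)) = e i := w.apply_symm_apply _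
  rw [this]; simp

end IsSigned

theorem rootReflection_apply (v x : V) :
    rootReflection v x = x - (2 * ⟪v, x⟫_ℝ / ⟪v, v⟫_ℝ) • v := by
  simp only [rootReflection, LinearIsometryEquiv.coe_toLinearEquiv,
    Submodule.reflection_orthogonal_apply, Submodule.reflection_singleton_apply,
    real_inner_self_eq_norm_sq]
  rw [two_smul, ← add_smul]
  simp only [RCLike.ofReal_real_eq_id, id]
  rw [neg_sub]; congr 2; ring

end Frame

/-! ### Weyl group elements as signed permutations, and the sign homomorphisms -/

section Signs

variable {V : Type*} [NormedAddCommGroup V] [InnerProductSpace ℝ V] {m : ℕ}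
variable {α : Module.Basis (Fin (m + 1)) ℝ V} {e : Fin (m + 1) → V} {κ c : ℝ}

theorem rootReflection_smul_apply {r : ℝ} (hr : r ≠ 0) (v x : V) :
    rootReflection (r • v) x = rootReflection v x := by
  simp only [rootReflection_apply, inner_smul_left, inner_smul_right, smul_smul, conj_trivial]
  congr 2
  by_cases hv : ⟪v, v⟫_ℝ = 0
  · rw [hv]; simp
  · field_simp

theorem rootReflection_apply_of_inner_eq_zero {v x : V} (h : ⟪v, x⟫_ℝ = 0) :
    rootReflection v x = x := by
  simp [rootReflection_apply, h]

namespace IsFrame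

theorem isSigned_smul (h : IsFrame α e κ c) {r : ℝ} (hr : r ≠ 0) (k : Fin (m + 1)) :
    IsSigned e (rootReflection (r • e k)) 1 (fun i => if i = k then -1 else 1) := fun i => by
  rw [rootReflection_smul_apply hr, rootReflection_apply, h.orth, h.orth, if_pos rfl]
  have := h.pos
  by_cases hi : i = k
  · subst hi
    simp only [if_true, Equiv.Perm.one_apply]
    have : 2 * c / c = 2 := by field_simp
    rw [this, two_smul]; simp
  · rw [if_neg (Ne.symm hi)]; simp [hi]

theorem isSigned_sub (h : IsFrame α e κ c) {k l : Fin (m + 1)} (hkl : k ≠ l) :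
    IsSigned e (rootReflection (e k - e l)) (Equiv.swap k l) 1 := fun i => by
  have hc := h.pos
  have hn : ⟪e k - e l, e k - e l⟫_ℝ = 2 * c := by
    simp only [inner_sub_left, inner_sub_right, h.orth, if_true, if_neg hkl, if_neg hkl.symm]; ring
  rw [rootReflection_apply, hn, inner_sub_left, h.orth, h.orth]
  by_cases h1 : k = i
  · subst h1
    rw [if_pos rfl, if_neg hkl.symm, Equiv.swap_apply_left]
    have : 2 * (c - 0) / (2 * c) = 1 := by field_simp; simp
    rw [this]; simp
  · by_cases h2 : l = i
    · subst h2
      rw [if_neg hkl, if_pos rfl, Equiv.swap_apply_right]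
      have : 2 * (0 - c) / (2 * c) = -1 := by field_simp; simp
      rw [this]; simp
    · rw [if_neg h1, if_neg h2, Equiv.swap_apply_of_ne_of_ne (Ne.symm h1) (Ne.symm h2)]; simp

theorem isSigned_add (h : IsFrame α e κ c) {k l : Fin (m + 1)} (hkl : k ≠ l) :
    IsSigned e (rootReflection (e k + e l)) (Equiv.swap k l)
      (fun i => (if i = k then -1 else 1) * (if i = l then -1 else 1)) := fun i => by
  have hc := h.pos
  have hn : ⟪e k + e l, e k + e l⟫_ℝ = 2 * c := by
    simp only [inner_add_left, inner_add_right, h.orth, if_true, if_neg hkl, if_neg hkl.symm]; ring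
  rw [rootReflection_apply, hn, inner_add_left, h.orth, h.orth]
  by_cases h1 : k = i
  · subst h1
    rw [if_pos rfl, if_neg hkl.symm, Equiv.swap_apply_left]
    have : 2 * (c + 0) / (2 * c) = 1 := by field_simp; simp
    rw [this]; simp [hkl]
  · by_cases h2 : l = i
    · subst h2
      rw [if_neg hkl, if_pos rfl, Equiv.swap_apply_right]
      have : 2 * (0 + c) / (2 * c) = 1 := by field_simp; simp
      rw [this]; simp [hkl.symm]
    · rw [if_neg h1, if_neg h2, Equiv.swap_apply_of_ne_of_ne (Ne.symm h1) (Ne.symm h2)]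
      simp [Ne.symm h1, Ne.symm h2]

theorem isSigned_simple (h : IsFrame α e κ c) (i : Fin m) :
    IsSigned e (rootReflection (α i.castSucc)) (Equiv.swap i.castSucc i.succ) 1 := by
  rw [h.simple]; exact h.isSigned_sub i.castSucc_lt_succ.ne

theorem isSigned_last (h : IsFrame α e κ c) :
    IsSigned e (rootReflection (α (Fin.last m))) 1 (fun i => if i = Fin.last m then -1 else 1) := by
  rw [h.last]; exact h.isSigned_smul h.scale_pos.ne' _

theorem exists_isSigned (h : IsFrame α e κ c) {w : V ≃ₗ[ℝ] V} (hw : w ∈ weylGroup α) :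
    ∃ π ε, IsSigned e w π ε := by
  induction hw using Subgroup.closure_induction with
  | mem w hw =>
    obtain ⟨i, rfl⟩ := hw
    induction i using Fin.lastCases with
    | last => exact ⟨_, _, h.isSigned_last⟩
    | cast i => exact ⟨_, _, h.isSigned_simple i⟩
  | one => exact ⟨_, _, IsSigned.one⟩
  | mul a b _ _ ha hb =>
    obtain ⟨π, ε, ha⟩ := ha
    obtain ⟨π', ε', hb⟩ := hb
    exact ⟨_, _, ha.mul hb⟩
  | inv a _ ha =>
    obtain ⟨π, ε, ha⟩ := ha
    exact ⟨_, _, ha.inv⟩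

theorem isSigned_unique (h : IsFrame α e κ c) {w : V ≃ₗ[ℝ] V} {π π' : Equiv.Perm (Fin (m + 1))}
    {ε ε' : Fin (m + 1) → ℤˣ} (h1 : IsSigned e w π ε) (h2 : IsSigned e w π' ε') :
    π = π' ∧ ε = ε' := by
  have hc := h.pos.ne'
  have key : ∀ i, π i = π' i ∧ ε i = ε' i := by
    intro i
    have h3 := congrArg (fun v => ⟪e (π i), v⟫_ℝ) ((h1 i).symm.trans (h2 i))
    simp only [inner_smul_right, h.orth, if_true] at h3
    have h4 : (((ε i : ℤˣ) : ℤ) : ℝ) ≠ 0 := fun h0 => by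
      have := unit_sq_real (ε i); rw [h0] at this; simp at this
    by_cases hp : π i = π' i
    · rw [if_pos hp] at h3
      have := mul_right_cancel₀ hc h3
      exact ⟨hp, Units.ext (by exact_mod_cast this)⟩
    · rw [if_neg hp, mul_zero] at h3
      exact absurd h3 (mul_ne_zero h4 hc)
  exact ⟨Equiv.ext fun i => (key i).1, funext fun i => (key i).2⟩

end IsFrame

/-- The homomorphism of `{±1}` that sends `-1` to `a`. -/
def unitsPick (a : ℤˣ) : ℤˣ →* ℤˣ := if a = 1 then 1 else MonoidHom.id _

@[simp] theorem unitsPick_neg_one (a : ℤˣ) : unitsPick a (-1) = a := by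
  unfold unitsPick
  rcases Int.units_eq_one_or a with rfl | rfl <;> simp

namespace IsFrame

/-- On signed permutations both `sign π` and `∏ ε` are multiplicative, the latter after reindexing
by `π'`; `unitsPick` switches each of them on or off. -/
theorem exists_hom (h : IsFrame α e κ c) (a b : ℤˣ) : ∃ χ : weylGroup α →* ℤˣ,
    ∀ (w : weylGroup α) π ε, IsSigned e w.1 π ε →
      χ w = unitsPick a (Equiv.Perm.sign π) * unitsPick b (∏ i, ε i) := by
  choose π ε hs using fun w : weylGroup α => h.exists_isSigned w.2
  refine ⟨MonoidHom.mk' (fun w => unitsPick a (Equiv.Perm.sign (π w)) * unitsPick b (∏ i, ε w i))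
    ?_, ?_⟩
  · intro w w'
    obtain ⟨h1, h2⟩ := h.isSigned_unique (hs (w * w')) ((hs w).mul (hs w'))
    rw [h1, h2, Finset.prod_mul_distrib, Equiv.prod_comp (π w') (ε w), map_mul, map_mul, map_mul]
    exact (by rw [mul_comm (unitsPick b (∏ i, ε w' i))]; exact mul_mul_mul_comm _ _ _ _)
  · intro w π' ε' h'
    obtain ⟨rfl, rfl⟩ := h.isSigned_unique (hs w) h'
    rfl

/-- `exists_hom` shows that the default value in `signHom` is not taken; the chosen homomorphism
agrees with the explicit one because the simple reflections generate. -/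
theorem signHom_of_isSigned (h : IsFrame α e κ c) {σ : SignKind} {a b : ℤˣ}
    (ha : ∀ i : Fin m, signValue α σ i.castSucc = a) (hb : signValue α σ (Fin.last m) = b)
    (w : weylGroup α) {π : Equiv.Perm (Fin (m + 1))} {ε : Fin (m + 1) → ℤˣ}
    (hw : IsSigned e w.1 π ε) :
    signHom α σ w = unitsPick a (Equiv.Perm.sign π) * unitsPick b (∏ i, ε i) := by
  obtain ⟨χ, hχ⟩ := h.exists_hom a b
  have hg : ∀ i, χ ⟨rootReflection (α i), Subgroup.subset_closure ⟨i, rfl⟩⟩ = signValue α σ i := by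
    intro i
    induction i using Fin.lastCases with
    | last => rw [hχ _ _ _ h.isSigned_last, hb]; simp
    | cast i =>
      rw [hχ _ _ _ (h.isSigned_simple i), ha, Equiv.Perm.sign_swap i.castSucc_lt_succ.ne]; simp
  have hex : ∃ χ : weylGroup α →* ℤˣ, ∀ i,
      χ ⟨rootReflection (α i), Subgroup.subset_closure ⟨i, rfl⟩⟩ = signValue α σ i := ⟨χ, hg⟩
  have heq : signHom α σ = hex.choose := by unfold signHom; rw [dif_pos hex]
  have hspec := hex.choose_spec
  rw [heq, ← hχ w π ε hw]
  obtain ⟨w, hw'⟩ := w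
  clear hw
  induction hw' using Subgroup.closure_induction with
  | mem w hw =>
    obtain ⟨i, rfl⟩ := hw
    rw [hg]; exact hspec i
  | one => exact (map_one _).trans (map_one _).symm
  | mul x y hx hy ihx ihy =>
    have := congrArg₂ (· * ·) ihx ihy
    simp only [← map_mul] at this
    exact this
  | inv x hx ihx =>
    have := congrArg (·⁻¹) ihx
    simp only [← map_inv] at this
    exact this

end IsFrame

/-! ### The highest root -/

theorem inner_isSigned {w : V ≃ₗ[ℝ] V} (hw : w ∈ weylGroup α) {π : Equiv.Perm (Fin (m + 1))}
    {ε : Fin (m + 1) → ℤˣ} (hs : IsSigned e w π ε) (i : Fin (m + 1)) (v : V) :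
    ⟪e (π i), w v⟫_ℝ = (((ε i : ℤˣ) : ℤ) : ℝ) * ⟪e i, v⟫_ℝ := by
  have h1 : e (π i) = (((ε i : ℤˣ) : ℤ) : ℝ) • w (e i) := by
    rw [hs, smul_smul, unit_sq_real, one_smul]
  rw [h1, inner_smul_left, weylGroup_inner α hw]; simp

namespace IsFrame

/-- Pairing with `e 0 + … + e j` telescopes: it kills every simple root except `α j`. Thus the root
order becomes a comparison of partial sums of coordinates. -/
theorem coord_mul (h : IsFrame α e κ c) (v : V) (j : Fin (m + 1)) :
    (c * if j = Fin.last m then κ else 1) * α.repr v j = ∑ i ∈ Finset.Iic j, ⟪e i, v⟫_ℝ := by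
  have hlin : (c * if j = Fin.last m then κ else 1) • α.coord j
      = ∑ i ∈ Finset.Iic j, (innerₗ V (e i)) := by
    refine α.ext fun k => ?_
    simp only [LinearMap.smul_apply, LinearMap.sum_apply, innerₗ_apply_apply, smul_eq_mul,
      Module.Basis.coord_apply, Module.Basis.repr_self, Finsupp.single_apply]
    induction k using Fin.lastCases with
    | last =>
      simp only [h.last, inner_smul_right, h.orth, ← Finset.mul_sum, Finset.sum_ite_eq',
        Finset.mem_Iic, Fin.last_le_iff]
      by_cases hj : j = Fin.last m
      · simp [hj, mul_comm]
      · simp [hj, Ne.symm hj]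
    | cast k =>
      simp only [h.simple, inner_sub_right, h.orth, Finset.sum_sub_distrib, Finset.sum_ite_eq',
        Finset.mem_Iic]
      have := k.2; have := j.2
      simp only [Fin.ext_iff, Fin.le_def, Fin.val_castSucc, Fin.val_succ, Fin.val_last]
      split_ifs <;> first | omega | simp
  have := LinearMap.congr_fun hlin v
  simpa only [LinearMap.smul_apply, LinearMap.sum_apply, innerₗ_apply_apply, smul_eq_mul,
    Module.Basis.coord_apply] using this

theorem repr_nonneg (h : IsFrame α e κ c) {v : V} {j : Fin (m + 1)}
    (hv : 0 ≤ ∑ i ∈ Finset.Iic j, ⟪e i, v⟫_ℝ) : 0 ≤ α.repr v j := by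
  rw [← h.coord_mul] at hv
  have hc := h.pos
  have hk := h.scale_pos
  refine nonneg_of_mul_nonneg_right hv ?_
  split_ifs <;> positivity

end IsFrame

theorem highestRoot_eq {ξ : V} (hξ : IsHighestRoot α ξ) : highestRoot α = ξ := by
  have hex : ∃ ξ, IsHighestRoot α ξ := ⟨ξ, hξ⟩
  unfold highestRoot
  rw [dif_pos hex]
  have h1 := hex.choose_spec.2 ξ hξ.1
  have h2 := hξ.2 _ hex.choose_spec.1
  refine α.repr.injective (Finsupp.ext fun i => le_antisymm ?_ ?_)
  · simpa using h2 i
  · simpa using h1 i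

theorem root_mem (i : Fin (m + 1)) : α i ∈ roots α := ⟨1, one_mem _, i, rfl⟩

theorem reflection_mem_roots {β : V} (hβ : β ∈ roots α) (i : Fin (m + 1)) :
    rootReflection (α i) β ∈ roots α := by
  obtain ⟨w, hw, j, rfl⟩ := hβ
  exact ⟨rootReflection (α i) * w, mul_mem (Subgroup.subset_closure ⟨i, rfl⟩) hw, j, rfl⟩

namespace IsFrame

/-- The sum of absolute coordinates is invariant under signed permutations, so only simple roots
need checking. It bounds the partial sums that decide which root is highest. -/
theorem root_bound (h : IsFrame α e κ c) (hκ : κ ≤ 2) {β : V} (hβ : β ∈ roots α) :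
    ∑ i, |⟪e i, β⟫_ℝ| ≤ 2 * c := by
  obtain ⟨w, hw, j, rfl⟩ := hβ
  obtain ⟨π, ε, hs⟩ := h.exists_isSigned hw
  have hc := h.pos
  have hk := h.scale_pos
  have habs : ∀ u : ℤˣ, |(((u : ℤˣ) : ℤ) : ℝ)| = 1 := fun u => by
    rcases Int.units_eq_one_or u with rfl | rfl <;> simp
  rw [← Equiv.sum_comp π]
  simp only [inner_isSigned hw hs, abs_mul, habs, one_mul]
  induction j using Fin.lastCases with
  | last =>
    simp only [h.last, inner_smul_right, h.orth, abs_mul, apply_ite abs, abs_zero,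
      abs_of_pos hc, abs_of_pos hk, ← Finset.mul_sum, Finset.sum_ite_eq', Finset.mem_univ, if_true]
    gcongr
  | cast j =>
    calc ∑ i, |⟪e i, α j.castSucc⟫_ℝ|
        ≤ ∑ i, ((if i = j.castSucc then c else 0) + (if i = j.succ then c else 0)) := by
          refine Finset.sum_le_sum fun i _ => ?_
          rw [h.simple, inner_sub_right, h.orth, h.orth]
          refine (abs_sub _ _).trans (le_of_eq ?_)
          rw [apply_ite abs, apply_ite abs, abs_zero, abs_of_pos hc]
      _ = 2 * c := by
          rw [Finset.sum_add_distrib, Finset.sum_ite_eq', Finset.sum_ite_eq']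
          simp; ring

theorem root_coord_bound (h : IsFrame α e 1 c) {β : V} (hβ : β ∈ roots α) (i : Fin (m + 1)) :
    ⟪e i, β⟫_ℝ ≤ c := by
  obtain ⟨w, hw, j, rfl⟩ := hβ
  obtain ⟨π, ε, hs⟩ := h.exists_isSigned hw
  have hc := h.pos
  obtain ⟨k, rfl⟩ := π.surjective i
  rw [inner_isSigned hw hs]
  have : |⟪e k, α j⟫_ℝ| ≤ c := by
    induction j using Fin.lastCases with
    | last =>
      rw [h.last, inner_smul_right, h.orth]
      split_ifs <;> simp [abs_of_pos hc, hc.le]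
    | cast j =>
      have hne := j.castSucc_lt_succ.ne
      rw [h.simple, inner_sub_right, h.orth, h.orth]
      split_ifs with h1 h2 h2
      · exact absurd (h1.symm.trans h2) hne
      all_goals simp [abs_of_pos hc, hc.le]
  rcases Int.units_eq_one_or (ε k) with h1 | h1 <;> rw [h1] <;> simp
  · exact (le_abs_self _).trans this
  · exact neg_le.1 (abs_le.1 this).1

/-- All partial sums of `2 e 0` equal `2c`, the maximum allowed by `root_bound`. It is a root
because simple reflections move `2 e m` up to it. -/
theorem isHighestRoot_C (h : IsFrame α e 2 c) : IsHighestRoot α ((2 : ℝ) • e 0) := by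
  constructor
  · suffices ∀ i, (2 : ℝ) • e i ∈ roots α from this 0
    intro i
    induction i using Fin.reverseInduction with
    | last => rw [← h.last]; exact root_mem _
    | cast i ih =>
      have := reflection_mem_roots ih i.castSucc
      rwa [map_smul, h.isSigned_simple, Equiv.swap_apply_right, Pi.one_apply, Units.val_one,
        Int.cast_one, one_smul] at this
  · intro β hβ j
    refine h.repr_nonneg ?_
    simp only [inner_sub_right, Finset.sum_sub_distrib, inner_smul_right, h.orth,
      ← Finset.mul_sum, Finset.sum_ite_eq', Finset.mem_Iic, Fin.zero_le, if_true, sub_nonneg]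
    calc ∑ i ∈ Finset.Iic j, ⟪e i, β⟫_ℝ ≤ ∑ i ∈ Finset.Iic j, |⟪e i, β⟫_ℝ| :=
          Finset.sum_le_sum fun i _ => le_abs_self _
      _ ≤ ∑ i, |⟪e i, β⟫_ℝ| :=
          Finset.sum_le_sum_of_subset_of_nonneg (Finset.subset_univ _) fun _ _ _ => abs_nonneg _
      _ ≤ 2 * c := h.root_bound le_rfl hβ

end IsFrame

/-- The partial sums of `e 0 + e 1` are `c, 2c, 2c, …`: the first is maximal by `root_coord_bound`,
the others by `root_bound`. -/
theorem IsFrame.isHighestRoot_B {α : Module.Basis (Fin (m + 1 + 1)) ℝ V} {e : Fin (m + 1 + 1) → V}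
    (h : IsFrame α e 1 c) : IsHighestRoot α (e 0 + e 1) := by
  constructor
  · suffices ∀ i : Fin (m + 1), e i.castSucc + e i.succ ∈ roots α from this 0
    intro i
    induction i using Fin.reverseInduction with
    | last =>
      have := reflection_mem_roots (root_mem (α := α) (Fin.last m).castSucc) (Fin.last (m + 1))
      rw [h.simple, map_sub, h.isSigned_last, h.isSigned_last] at this
      simpa [(Fin.castSucc_lt_last (Fin.last m)).ne] using this
    | cast i ih =>
      -- Two reflections shift the pair by one: `e (i+1) + e (i+2) ↦ e i + e (i+2) ↦ e i + e (i+1)`.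
      have h1 := reflection_mem_roots ih i.castSucc.castSucc
      have hne : i.succ.succ ≠ i.castSucc.castSucc := by simp [Fin.ext_iff]; omega
      have hne' : i.succ.succ ≠ i.castSucc.succ := by simp [Fin.ext_iff]
      have hne'' : i.castSucc.castSucc ≠ i.succ.castSucc := by simp [Fin.ext_iff]
      rw [map_add, h.isSigned_simple, h.isSigned_simple, Equiv.swap_apply_of_ne_of_ne hne hne',
        ← Fin.succ_castSucc, Equiv.swap_apply_right] at h1
      have h2 := reflection_mem_roots h1 i.succ.castSucc
      rw [map_add, map_smul, map_smul, h.isSigned_simple, h.isSigned_simple,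
        Equiv.swap_apply_right, Equiv.swap_apply_of_ne_of_ne hne'' hne.symm] at h2
      simpa using h2
  · intro β hβ j
    refine h.repr_nonneg ?_
    simp only [inner_sub_right, inner_add_right, Finset.sum_sub_distrib, Finset.sum_add_distrib,
      h.orth, Finset.sum_ite_eq', Finset.mem_Iic, Fin.zero_le, if_true, sub_nonneg]
    by_cases hj : j = 0
    · subst hj
      have : Finset.Iic (0 : Fin (m + 1 + 1)) = {0} := by ext i; simp
      rw [this, Finset.sum_singleton, if_neg (by simp), add_zero]
      exact h.root_coord_bound hβ 0
    · rw [if_pos (by rw [Fin.le_def]; have := Fin.pos_of_ne_zero hj; rw [Fin.lt_def] at this; simp at this ⊢; omega)]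
      calc ∑ i ∈ Finset.Iic j, ⟪e i, β⟫_ℝ ≤ ∑ i ∈ Finset.Iic j, |⟪e i, β⟫_ℝ| :=
            Finset.sum_le_sum fun i _ => le_abs_self _
        _ ≤ ∑ i, |⟪e i, β⟫_ℝ| :=
            Finset.sum_le_sum_of_subset_of_nonneg (Finset.subset_univ _) fun _ _ _ => abs_nonneg _
        _ ≤ 2 * c := h.root_bound one_le_two hβ
        _ = c + c := two_mul c

end Signs

/-! ### The affine Weyl group and the signed domain in coordinates -/

section Affine

variable {V : Type*} [NormedAddCommGroup V] [InnerProductSpace ℝ V] {m : ℕ}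
variable {α : Module.Basis (Fin (m + 1)) ℝ V} {e : Fin (m + 1) → V} {κ c : ℝ}

/-- `f` is `a ↦ w a + q` with `w` a signed permutation of the `e i` and `q` with integral coordinates
whose sum is divisible by `d`. -/
def IsSignedAffine (e : Fin (m + 1) → V) (d : ℤ) (f : V ≃ᵃ[ℝ] V) (π : Equiv.Perm (Fin (m + 1)))
    (ε : Fin (m + 1) → ℤˣ) (q : Fin (m + 1) → ℤ) : Prop :=
  IsSigned e f.linear π ε ∧ (∀ i, ⟪e i, f 0⟫_ℝ = q i) ∧ d ∣ ∑ i, q i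

theorem dvd_signed_sum {d : ℤ} (hd : d ∣ 2) {ι : Type*} (s : Finset ι) (ε : ι → ℤˣ) (q : ι → ℤ)
    (hq : d ∣ ∑ i ∈ s, q i) : d ∣ ∑ i ∈ s, (ε i : ℤ) * q i := by
  have h1 : d ∣ ∑ i ∈ s, ((ε i : ℤ) * q i - q i) := by
    refine Finset.dvd_sum fun i _ => ?_
    rcases Int.units_eq_one_or (ε i) with h | h
    · simp [h]
    · refine hd.trans ⟨-q i, ?_⟩
      rw [h]; push_cast; ring
  rw [Finset.sum_sub_distrib] at h1
  exact (dvd_sub_left hq).1 h1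

theorem zpow_sum_eq_prod {G ι : Type*} [CommGroup G] (t : G) (s : Finset ι) (q : ι → ℤ) :
    t ^ ∑ i ∈ s, q i = ∏ i ∈ s, t ^ q i := by
  classical
  induction s using Finset.induction_on with
  | empty => simp
  | insert i s hi ih => rw [Finset.sum_insert hi, Finset.prod_insert hi, zpow_add, ih]

theorem affineEquiv_apply (f : V ≃ᵃ[ℝ] V) (a : V) : f a = f.linear a + f 0 := by
  have := f.map_vadd 0 a
  simpa using this

theorem apply_affineReflection (a : V) :
    affineReflection α a = rootReflection (highestRoot α) a + coroot (highestRoot α) := by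
  simp [affineReflection, add_comm]

namespace IsFrame

/-- Sign changes alter a coordinate sum by an even number, so divisibility by `d ∣ 2` survives
products and inverses, and only `r₀` has to be checked. Type C uses `d = 1`, type B uses `d = 2`. -/
theorem exists_isSignedAffine (h : IsFrame α e κ c) {d : ℤ} (hd : d ∣ 2)
    (h0 : ∃ π ε q, IsSignedAffine e d (affineReflection α) π ε q) {f : V ≃ᵃ[ℝ] V}
    (hf : f ∈ affineWeylGroup α) : ∃ π ε q, IsSignedAffine e d f π ε q := by
  induction hf using Subgroup.closure_induction with
  | mem f hf =>
    rcases hf with rfl | ⟨i, rfl⟩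
    · exact h0
    · obtain ⟨π, ε, hs⟩ := h.exists_isSigned (w := rootReflection (α i))
        (Subgroup.subset_closure ⟨i, rfl⟩)
      exact ⟨π, ε, 0, hs, by simp, by simp⟩
  | one => exact ⟨1, 1, 0, IsSigned.one, by simp, by simp⟩
  | mul f g hf hg ihf ihg =>
    obtain ⟨π, ε, q, h1, h2, h3⟩ := ihf
    obtain ⟨π', ε', q', h1', h2', h3'⟩ := ihg
    refine ⟨π * π', _, fun i => (ε (π⁻¹ i) : ℤ) * q' (π⁻¹ i) + q i, h1.mul h1', fun i => ?_, ?_⟩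
    · rw [AffineEquiv.mul_def, AffineEquiv.trans_apply, affineEquiv_apply f, inner_add_right, h2]
      obtain ⟨k, rfl⟩ := π.surjective i
      rw [inner_isSigned (linear_mem_weylGroup α hf) h1, h2']
      simp
    · rw [Finset.sum_add_distrib, Equiv.sum_comp π⁻¹ (fun i => (ε i : ℤ) * q' i)]
      exact dvd_add (dvd_signed_sum hd _ _ _ h3') h3
  | inv f hf ihf =>
    obtain ⟨π, ε, q, h1, h2, h3⟩ := ihf
    refine ⟨π⁻¹, _, fun i => -((ε i : ℤ) * q (π i)), h1.inv, fun i => ?_, ?_⟩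
    · have hz : f ((f⁻¹ : V ≃ᵃ[ℝ] V) 0) = 0 := f.apply_symm_apply 0
      rw [affineEquiv_apply] at hz
      have h4 := inner_isSigned (linear_mem_weylGroup α hf) h1 i ((f⁻¹ : V ≃ᵃ[ℝ] V) 0)
      rw [eq_neg_of_add_eq_zero_left hz, inner_neg_right, h2] at h4
      have h5 := congrArg ((((ε i : ℤˣ) : ℤ) : ℝ) * ·) h4
      simp only [← mul_assoc, unit_sq_real, one_mul] at h5
      rw [← h5]; push_cast; ring
    · rw [Finset.sum_neg_distrib, dvd_neg]
      exact dvd_signed_sum hd _ _ _ (by rwa [Equiv.sum_comp π q])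

end IsFrame

theorem fixed_coord {d : ℤ} {f : V ≃ᵃ[ℝ] V} (hf : f ∈ affineWeylGroup α)
    {π : Equiv.Perm (Fin (m + 1))} {ε : Fin (m + 1) → ℤˣ} {q : Fin (m + 1) → ℤ}
    (h : IsSignedAffine e d f π ε q) {a : V} (ha : f a = a) (i : Fin (m + 1)) :
    ⟪e (π i), a⟫_ℝ = (((ε i : ℤˣ) : ℤ) : ℝ) * ⟪e i, a⟫_ℝ + q (π i) := by
  conv_lhs => rw [← ha, affineEquiv_apply, inner_add_right,
    inner_isSigned (linear_mem_weylGroup α hf) h.1, h.2.1]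

/-- `θ_ρ` takes the value `t ^ ∑ qᵢ` on every element with translation part of coordinates `qᵢ`. -/
def ThetaSign (α : Module.Basis (Fin (m + 1)) ℝ V) (e : Fin (m + 1) → V) (ρ : V) (t : ℤˣ) : Prop :=
  ∀ (f : affineWeylGroup α) (q : Fin (m + 1) → ℤ), (∀ i, ⟪e i, f.1 0⟫_ℝ = q i) →
    theta α ρ f = (((t ^ ∑ i, q i : ℤˣ) : ℤ) : ℂ)

theorem thetaSign_zero : ThetaSign α e 0 1 := fun f q _ => by
  simp [theta]

/-- Modulo integers `⟪q, ρ⟫` is `(∑ qᵢ) / 2`, whence the sign `(-1) ^ ∑ qᵢ`. -/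
theorem IsFrame.thetaSign_half (h : IsFrame α e κ c) {ρ : V}
    (hρ : ∀ i, ∃ k : ℤ, ⟪e i, ρ⟫_ℝ / c = k + 1 / 2) : ThetaSign α e ρ (-1) := fun f q hq => by
  choose k hk using hρ
  have h1 : ⟪f.1 0, ρ⟫_ℝ = (∑ i, q i * k i : ℤ) + (∑ i, q i : ℤ) / 2 := by
    rw [h.inner_eq]
    simp only [hq, hk]
    push_cast
    rw [Finset.sum_div, ← Finset.sum_add_distrib]
    exact Finset.sum_congr rfl fun i _ => by ring
  rw [theta, translationPart, h1]
  set N := ∑ i, q i * k i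
  set S := ∑ i, q i
  have h2 : (2 * Real.pi * Complex.I * (((N : ℝ) + (S : ℝ) / 2 : ℝ) : ℂ) : ℂ) =
      S * (Real.pi * Complex.I) + N * (2 * Real.pi * Complex.I) := by push_cast; ring
  rw [h2, Complex.exp_add, Complex.exp_int_mul_two_pi_mul_I, mul_one, Complex.exp_int_mul,
    Complex.exp_pi_mul_I]
  rcases Int.even_or_odd S with hS | hS
  · rw [hS.neg_one_zpow, hS.neg_one_zpow]; simp
  · rw [hS.neg_one_zpow, hS.neg_one_zpow]; simp

/-- The sign homomorphism `σ` takes the value `a` on the reflections in `α₀, …, αₘ₋₁` and `b` on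
the reflection in `αₘ`. -/
def SignPair (α : Module.Basis (Fin (m + 1)) ℝ V) (σ : SignKind) (a b : ℤˣ) : Prop :=
  (∀ i : Fin m, signValue α σ i.castSucc = a) ∧ signValue α σ (Fin.last m) = b

theorem signPair_one : SignPair α .one 1 1 := ⟨fun _ => rfl, rfl⟩

theorem signPair_e : SignPair α .e (-1) (-1) := ⟨fun _ => rfl, rfl⟩

namespace IsFrame

theorem gamma_eq (h : IsFrame α e κ c) {σ : SignKind} {a b t : ℤˣ} (hσ : SignPair α σ a b) {ρ : V}
    (ht : ThetaSign α e ρ t) {d : ℤ} (f : affineWeylGroup α) {π : Equiv.Perm (Fin (m + 1))}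
    {ε : Fin (m + 1) → ℤˣ} {q : Fin (m + 1) → ℤ} (hf : IsSignedAffine e d f.1 π ε q) :
    gamma α σ ρ f = ((((t ^ ∑ i, q i) *
      (unitsPick a (Equiv.Perm.sign π) * unitsPick b (∏ i, ε i)) : ℤˣ) : ℤ) : ℂ) := by
  rw [gamma, ht f q hf.2.1, h.signHom_of_isSigned hσ.1 hσ.2 (retraction α f) hf.1]
  push_cast; ring

theorem gamma_eq_one_iff (h : IsFrame α e κ c) {σ : SignKind} {a b t : ℤˣ} (hσ : SignPair α σ a b)
    {ρ : V} (ht : ThetaSign α e ρ t) {d : ℤ} (f : affineWeylGroup α)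
    {π : Equiv.Perm (Fin (m + 1))} {ε : Fin (m + 1) → ℤˣ} {q : Fin (m + 1) → ℤ}
    (hf : IsSignedAffine e d f.1 π ε q) :
    gamma α σ ρ f = 1 ↔ (t ^ ∑ i, q i) *
      (unitsPick a (Equiv.Perm.sign π) * unitsPick b (∏ i, ε i)) = 1 := by
  rw [h.gamma_eq hσ ht f hf, Int.cast_eq_one, Units.val_eq_one]

/-- A point on a simple wall is fixed by its reflection, which has no translation part, so `γ`
reduces there to `σ`. -/
theorem simple_orth (h : IsFrame α e κ c) {σ : SignKind} {a b t : ℤˣ} (hσ : SignPair α σ a b)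
    {ρ : V} (ht : ThetaSign α e ρ t) {x : V} (hx : x ∈ signedDomain α σ ρ) {j : Fin (m + 1)}
    (hj : ⟪α j, x⟫_ℝ = 0) : signValue α σ j = 1 := by
  let f : affineWeylGroup α := ⟨(rootReflection (α j)).toAffineEquiv,
    Subgroup.subset_closure (Or.inr ⟨j, rfl⟩)⟩
  have h1 := hx.2 f (rootReflection_apply_of_inner_eq_zero hj)
  induction j using Fin.lastCases with
  | last =>
    rw [h.gamma_eq_one_iff hσ ht (d := 1) (q := 0) f ⟨h.isSigned_last, by simp [f], by simp⟩] at h1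
    rw [hσ.2]; simpa using h1
  | cast j =>
    rw [h.gamma_eq_one_iff hσ ht (d := 1) (q := 0) f ⟨h.isSigned_simple j, by simp [f], by simp⟩,
      Equiv.Perm.sign_swap j.castSucc_lt_succ.ne] at h1
    rw [hσ.1]; simpa using h1

theorem dominant_iff (h : IsFrame α e κ c) (x : V) :
    (∀ i, 0 ≤ ⟪α i, x⟫_ℝ) ↔ Antitone (fun i => ⟪e i, x⟫_ℝ) ∧ ∀ i, 0 ≤ ⟪e i, x⟫_ℝ := by
  have hk := h.scale_pos
  have h1 : ∀ i : Fin m, ⟪α i.castSucc, x⟫_ℝ = ⟪e i.castSucc, x⟫_ℝ - ⟪e i.succ, x⟫_ℝ :=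
    fun i => by rw [h.simple, inner_sub_left]
  have h2 : ⟪α (Fin.last m), x⟫_ℝ = κ * ⟪e (Fin.last m), x⟫_ℝ := by
    rw [h.last, inner_smul_left]; simp
  constructor
  · intro hx
    have ha : Antitone (fun i => ⟪e i, x⟫_ℝ) := by
      rw [Fin.antitone_iff_succ_le]
      intro i
      have := hx i.castSucc
      rw [h1] at this
      exact sub_nonneg.1 this
    refine ⟨ha, fun i => le_trans ?_ (ha (Fin.le_last i))⟩
    have := hx (Fin.last m)
    rw [h2] at this
    exact nonneg_of_mul_nonneg_right this hk
  · rintro ⟨ha, hp⟩ i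
    induction i using Fin.lastCases with
    | last => rw [h2]; exact mul_nonneg hk.le (hp _)
    | cast i => rw [h1]; exact sub_nonneg.2 (ha i.castSucc_lt_succ.le)

theorem mem_fundamentalDomain (h : IsFrame α e κ c) (x : V) :
    x ∈ fundamentalDomain α ↔ (Antitone (fun i => ⟪e i, x⟫_ℝ) ∧ ∀ i, 0 ≤ ⟪e i, x⟫_ℝ) ∧
      ⟪highestRoot α, x⟫_ℝ ≤ 1 := by
  have h1 : ∑ i, mark α i * ⟪α i, x⟫_ℝ = ⟪highestRoot α, x⟫_ℝ := by
    conv_rhs => rw [← α.sum_repr (highestRoot α), sum_inner]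
    simp [mark, inner_smul_left]
  rw [← h.dominant_iff]
  refine and_congr Iff.rfl ?_
  rw [h1]
  constructor
  · rintro ⟨y, hy, hs⟩; linarith
  · intro hx; exact ⟨1 - ⟪highestRoot α, x⟫_ℝ, by linarith, by ring⟩

theorem strictAnti_of_mem (h : IsFrame α e κ c) {σ : SignKind} {b t : ℤˣ}
    (hσ : SignPair α σ (-1) b) {ρ : V} (ht : ThetaSign α e ρ t) {x : V}
    (hx : x ∈ signedDomain α σ ρ) : StrictAnti (fun i => ⟪e i, x⟫_ℝ) := by
  rw [Fin.strictAnti_iff_succ_lt]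
  intro i
  have ha := ((h.mem_fundamentalDomain x).1 hx.1).1.1
  refine lt_of_le_of_ne (ha i.castSucc_lt_succ.le) fun heq => ?_
  have := h.simple_orth hσ ht hx (j := i.castSucc)
    (by rw [h.simple, inner_sub_left]; exact sub_eq_zero.2 heq.symm)
  rw [hσ.1] at this
  exact absurd this (by decide)

/-! ### Type `C` -/

theorem highestRoot_C (h : IsFrame α e 2 c) : highestRoot α = (2 : ℝ) • e 0 :=
  highestRoot_eq h.isHighestRoot_C

theorem inner_coroot_C (h : IsFrame α e 2 c) (i : Fin (m + 1)) :
    ⟪e i, coroot ((2 : ℝ) • e 0)⟫_ℝ = ((if i = 0 then 1 else 0 : ℤ) : ℝ) := by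
  have := h.pos
  simp only [coroot, inner_smul_left, inner_smul_right, h.orth, if_true, conj_trivial]
  split_ifs
  · field_simp; norm_num
  · simp

theorem isSignedAffine_C (h : IsFrame α e 2 c) :
    IsSignedAffine e 1 (affineReflection α) 1 (fun i => if i = 0 then -1 else 1)
      (fun i => if i = 0 then 1 else 0) := by
  refine ⟨?_, fun i => ?_, one_dvd _⟩
  · have := h.isSigned_smul two_ne_zero 0
    rw [← h.highestRoot_C] at this
    exact this
  · rw [apply_affineReflection, map_zero, zero_add, h.highestRoot_C, h.inner_coroot_C]

/-- Necessity tests the wall reflections; `r₀` contributes `b t`. Sufficiency treats an arbitrary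
stabilizer element coordinate by coordinate, without using that stabilizers are generated by
reflections. -/
theorem mem_signedDomain_C (h : IsFrame α e 2 c) {σ : SignKind} {a b t : ℤˣ}
    (hσ : SignPair α σ a b) {ρ : V} (ht : ThetaSign α e ρ t) (x : V) :
    x ∈ signedDomain α σ ρ ↔ Antitone (fun i => ⟪e i, x⟫_ℝ) ∧
      (∀ i, 0 ≤ ⟪e i, x⟫_ℝ ∧ 2 * ⟪e i, x⟫_ℝ ≤ 1) ∧
      (a = -1 → StrictAnti (fun i => ⟪e i, x⟫_ℝ)) ∧ (b = -1 → ∀ i, ⟪e i, x⟫_ℝ ≠ 0) ∧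
      (b * t = -1 → ∀ i, 2 * ⟪e i, x⟫_ℝ ≠ 1) := by
  have hF : x ∈ fundamentalDomain α ↔ Antitone (fun i => ⟪e i, x⟫_ℝ) ∧
      (∀ i, 0 ≤ ⟪e i, x⟫_ℝ ∧ 2 * ⟪e i, x⟫_ℝ ≤ 1) := by
    rw [h.mem_fundamentalDomain, h.highestRoot_C, inner_smul_left]
    simp only [conj_trivial]
    constructor
    · rintro ⟨⟨ha, hp⟩, h1⟩
      exact ⟨ha, fun i => ⟨hp i, le_trans (by have := ha (Fin.zero_le i); dsimp at this; linarith) h1⟩⟩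
    · rintro ⟨ha, hp⟩
      exact ⟨⟨ha, fun i => (hp i).1⟩, (hp 0).2⟩
  constructor
  · intro hx
    obtain ⟨ha, hp⟩ := hF.1 hx.1
    refine ⟨ha, hp, ?_, ?_, ?_⟩
    · rintro rfl; exact h.strictAnti_of_mem hσ ht hx
    · rintro rfl i hi
      have h0 : ⟪e (Fin.last m), x⟫_ℝ = 0 :=
        le_antisymm (hi ▸ ha (Fin.le_last i)) (hp _).1
      have := h.simple_orth hσ ht hx (j := Fin.last m)
        (by rw [h.last, inner_smul_left, h0, mul_zero])
      rw [hσ.2] at this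
      exact absurd this (by decide)
    · intro hbt i hi
      have h0 : 2 * ⟪e 0, x⟫_ℝ = 1 :=
        le_antisymm (hp _).2 (by have := ha (Fin.zero_le i); dsimp at this; linarith)
      let f : affineWeylGroup α := ⟨affineReflection α, Subgroup.subset_closure (Or.inl rfl)⟩
      have hfix : f.1 x = x := by
        change affineReflection α x = x
        have hc := h.pos
        rw [apply_affineReflection, h.highestRoot_C, rootReflection_apply, coroot, inner_smul_left,
          conj_trivial, h0, mul_one]
        abel
      have h1 := hx.2 f hfix
      rw [h.gamma_eq_one_iff hσ ht f h.isSignedAffine_C] at h1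
      simp only [Finset.sum_ite_eq', Finset.mem_univ, if_true, zpow_one, map_one, one_mul,
        Finset.prod_ite_eq', unitsPick_neg_one] at h1
      rw [mul_comm, hbt] at h1
      exact absurd h1 (by decide)
  · rintro ⟨ha, hp, hA, hB, hBT⟩
    refine ⟨hF.2 ⟨ha, hp⟩, fun f hf => ?_⟩
    obtain ⟨π, ε, q, hs⟩ := h.exists_isSignedAffine (one_dvd 2) ⟨_, _, _, h.isSignedAffine_C⟩ f.2
    have hfix := fixed_coord f.2 hs hf
    -- As coordinates lie in `[0, 1/2]`, sign `+` forces `q = 0`; sign `-` forces `q = 0` with both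
    -- coordinates `0`, or `q = 1` with both `1/2`. The last two give the factors `b` and `b t`, and
    -- the hypotheses exclude the value `-1`.
    have key : ∀ i, ⟪e (π i), x⟫_ℝ = ⟪e i, x⟫_ℝ ∧ t ^ q (π i) * unitsPick b (ε i) = 1 := by
      intro i
      have h1 := hfix i
      obtain ⟨p1, p2⟩ := hp i
      obtain ⟨p3, p4⟩ := hp (π i)
      rcases Int.units_eq_one_or (ε i) with he | he
      · rw [he] at h1 ⊢
        have h2 : q (π i) = 0 := by
          have l1 : (-1 : ℝ) < q (π i) := by push_cast at h1; linarith
          have l2 : (q (π i) : ℝ) < 1 := by push_cast at h1; linarith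
          have l1' : (-1 : ℤ) < q (π i) := by exact_mod_cast l1
          have l2' : q (π i) < 1 := by exact_mod_cast l2
          omega
        rw [h2] at h1 ⊢
        simp at h1
        exact ⟨h1, by simp⟩
      · rw [he] at h1 ⊢
        have h2 : q (π i) = 0 ∨ q (π i) = 1 := by
          have l1 : (0 : ℝ) ≤ q (π i) := by push_cast at h1; linarith
          have l2 : (q (π i) : ℝ) ≤ 1 := by push_cast at h1; linarith
          have l1' : (0 : ℤ) ≤ q (π i) := by exact_mod_cast l1
          have l2' : q (π i) ≤ 1 := by exact_mod_cast l2
          omega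
        rw [unitsPick_neg_one]
        rcases h2 with h2 | h2 <;> rw [h2] at h1 ⊢ <;> push_cast at h1
        · refine ⟨by linarith, ?_⟩
          rcases Int.units_eq_one_or b with hb | hb
          · simp [hb]
          · exact absurd (by linarith) (hB hb i)
        · refine ⟨by linarith, ?_⟩
          rw [zpow_one, mul_comm]
          rcases Int.units_eq_one_or (b * t) with hb | hb
          · exact hb
          · exact absurd (by linarith) (hBT hb i)
    rw [h.gamma_eq_one_iff hσ ht f hs]
    have hsgn : unitsPick a (Equiv.Perm.sign π) = 1 := by
      rcases Int.units_eq_one_or a with hA' | hA'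
      · simp [unitsPick, hA']
      · have : π = 1 := Equiv.ext fun i => (hA hA').injective (key i).1
        simp [this]
    have hz : (t ^ ∑ i, q i) = ∏ i, t ^ q (π i) := by
      rw [← Equiv.sum_comp π q]
      exact zpow_sum_eq_prod _ _ _
    rw [hsgn, one_mul, hz, map_prod, ← Finset.prod_mul_distrib]
    exact Finset.prod_eq_one fun i _ => (key i).2

end IsFrame

end Affine

/-! ### Type `B` -/

section TypeB

variable {V : Type*} [NormedAddCommGroup V] [InnerProductSpace ℝ V] {m : ℕ}
variable {α : Module.Basis (Fin (m + 1 + 1)) ℝ V} {e : Fin (m + 1 + 1) → V} {c : ℝ}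

namespace IsFrame

theorem highestRoot_B (h : IsFrame α e 1 c) : highestRoot α = e 0 + e 1 :=
  highestRoot_eq h.isHighestRoot_B

theorem inner_coroot_B (h : IsFrame α e 1 c) (i : Fin (m + 1 + 1)) :
    ⟪e i, coroot (e 0 + e 1)⟫_ℝ =
      (((if i = 0 then 1 else 0) + (if i = 1 then 1 else 0) : ℤ) : ℝ) := by
  have := h.pos
  have hn : ⟪e 0 + e 1, e 0 + e 1⟫_ℝ = 2 * c := by
    simp only [inner_add_left, inner_add_right, h.orth]; simp; ring
  rw [coroot, inner_smul_right, hn, inner_add_right, h.orth, h.orth]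
  push_cast
  split_ifs <;> field_simp <;> norm_num

theorem isSignedAffine_B (h : IsFrame α e 1 c) :
    IsSignedAffine e 2 (affineReflection α) (Equiv.swap 0 1)
      (fun i => (if i = 0 then -1 else 1) * (if i = 1 then -1 else 1))
      (fun i => (if i = 0 then 1 else 0) + (if i = 1 then 1 else 0)) := by
  refine ⟨?_, fun i => ?_, ?_⟩
  · have := h.isSigned_add (k := 0) (l := 1) (by simp)
    rw [← h.highestRoot_B] at this
    exact this
  · rw [apply_affineReflection, map_zero, zero_add, h.highestRoot_B, h.inner_coroot_B]
  · rw [Finset.sum_add_distrib, Finset.sum_ite_eq', Finset.sum_ite_eq']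
    simp

/-- Away from the walls `xᵢ = 0` the value `b` drops out: in a stabilizer the number of sign changes
has the parity of `∑ q`, which is even in type B. -/
theorem mem_signedDomain_B (h : IsFrame α e 1 c) {σ : SignKind} {a b : ℤˣ}
    (hσ : SignPair α σ a b) {x : V} (hx0 : ∀ i, ⟪e i, x⟫_ℝ ≠ 0) :
    x ∈ signedDomain α σ 0 ↔ Antitone (fun i => ⟪e i, x⟫_ℝ) ∧ (∀ i, 0 ≤ ⟪e i, x⟫_ℝ) ∧
      ⟪e 0, x⟫_ℝ + ⟪e 1, x⟫_ℝ ≤ 1 ∧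
      (a = -1 → StrictAnti (fun i => ⟪e i, x⟫_ℝ) ∧ ⟪e 0, x⟫_ℝ + ⟪e 1, x⟫_ℝ ≠ 1) := by
  have hF : x ∈ fundamentalDomain α ↔ (Antitone (fun i => ⟪e i, x⟫_ℝ) ∧ ∀ i, 0 ≤ ⟪e i, x⟫_ℝ) ∧
      ⟪e 0, x⟫_ℝ + ⟪e 1, x⟫_ℝ ≤ 1 := by
    rw [h.mem_fundamentalDomain, h.highestRoot_B, inner_add_left]
  have ht := thetaSign_zero (α := α) (e := e)
  constructor
  · intro hx
    obtain ⟨⟨ha, hp⟩, h1⟩ := hF.1 hx.1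
    refine ⟨ha, hp, h1, ?_⟩
    rintro rfl
    refine ⟨h.strictAnti_of_mem hσ ht hx, fun h2 => ?_⟩
    let f : affineWeylGroup α := ⟨affineReflection α, Subgroup.subset_closure (Or.inl rfl)⟩
    have hfix : f.1 x = x := by
      change affineReflection α x = x
      rw [apply_affineReflection, h.highestRoot_B, rootReflection_apply, coroot, inner_add_left,
        h2, mul_one]
      abel
    have h3 := hx.2 f hfix
    rw [h.gamma_eq_one_iff hσ ht f h.isSignedAffine_B] at h3
    rw [Finset.prod_mul_distrib, Finset.prod_ite_eq', Finset.prod_ite_eq',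
      Equiv.Perm.sign_swap (by simp)] at h3
    simp at h3
  · rintro ⟨ha, hp, h1, hA⟩
    refine ⟨hF.2 ⟨⟨ha, hp⟩, h1⟩, fun f hf => ?_⟩
    obtain ⟨π, ε, q, hs⟩ := h.exists_isSignedAffine dvd_rfl ⟨_, _, _, h.isSignedAffine_B⟩ f.2
    have hfix := fixed_coord f.2 hs hf
    have hpos : ∀ i, 0 < ⟪e i, x⟫_ℝ := fun i => lt_of_le_of_ne (hp i) (hx0 i).symm
    have hlt : ∀ i, ⟪e i, x⟫_ℝ < 1 := fun i => by
      have l1 := ha (Fin.zero_le i)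
      have l2 := hpos 1
      dsimp at l1
      linarith
    have hpair : ∀ i j, i ≠ j → ⟪e i, x⟫_ℝ + ⟪e j, x⟫_ℝ ≤ ⟪e 0, x⟫_ℝ + ⟪e 1, x⟫_ℝ := by
      have : ∀ i j, i < j → ⟪e i, x⟫_ℝ + ⟪e j, x⟫_ℝ ≤ ⟪e 0, x⟫_ℝ + ⟪e 1, x⟫_ℝ := fun i j hij =>
        add_le_add (ha (Fin.zero_le i)) (ha (Fin.one_le_of_ne_zero (Fin.ne_zero_of_lt hij)))
      intro i j hij
      rcases lt_or_gt_of_ne hij with hlt | hlt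
      · exact this i j hlt
      · rw [add_comm]; exact this j i hlt
    -- All coordinates lie strictly between `0` and `1`, so sign `+` means `q = 0` and sign `-`
    -- means `q = 1`, that is, two coordinates of sum `1`. If these were distinct coordinates,
    -- `hpair` would put `x` on the wall of `r₀`.
    have key : ∀ i, ε i = (-1) ^ q (π i) ∧ (a = -1 → π i = i) := by
      intro i
      have h2 := hfix i
      have p1 := hpos i
      have p2 := hlt i
      have p3 := hpos (π i)
      have p4 := hlt (π i)
      rcases Int.units_eq_one_or (ε i) with he | he <;> rw [he] at h2 ⊢
      · have h3 : q (π i) = 0 := by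
          have l1 : (-1 : ℝ) < q (π i) := by push_cast at h2; linarith
          have l2 : (q (π i) : ℝ) < 1 := by push_cast at h2; linarith
          have l1' : (-1 : ℤ) < q (π i) := by exact_mod_cast l1
          have l2' : q (π i) < 1 := by exact_mod_cast l2
          omega
        rw [h3] at h2 ⊢
        refine ⟨by simp, fun hA' => (hA hA').1.injective ?_⟩
        simpa using h2
      · have h3 : q (π i) = 1 := by
          have l1 : (0 : ℝ) < q (π i) := by push_cast at h2; linarith
          have l2 : (q (π i) : ℝ) < 2 := by push_cast at h2; linarith
          have l1' : (0 : ℤ) < q (π i) := by exact_mod_cast l1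
          have l2' : q (π i) < 2 := by exact_mod_cast l2
          omega
        rw [h3] at h2 ⊢
        push_cast at h2
        refine ⟨by simp, fun hA' => by_contra fun hne => (hA hA').2 (le_antisymm h1 ?_)⟩
        have := hpair _ _ hne
        linarith
    rw [h.gamma_eq_one_iff hσ ht f hs]
    have hsgn : unitsPick a (Equiv.Perm.sign π) = 1 := by
      rcases Int.units_eq_one_or a with hA' | hA'
      · simp [unitsPick, hA']
      · have : π = 1 := Equiv.ext fun i => (key i).2 hA'
        simp [this]
    have hprod : ∏ i, ε i = 1 := by
      simp only [fun i => (key i).1]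
      rw [← zpow_sum_eq_prod, Equiv.sum_comp π q]
      exact (even_iff_two_dvd.2 hs.2.2).neg_one_zpow
    simp [hsgn, hprod]

end IsFrame

end TypeB

/-! ### Lattices, shifts and sign homomorphisms in coordinates -/

section Lattices

variable {V : Type*} [NormedAddCommGroup V] [InnerProductSpace ℝ V] {m : ℕ}
variable {α : Module.Basis (Fin (m + 1)) ℝ V} {e : Fin (m + 1) → V} {κ c : ℝ}

theorem reflection_sub_mem {L : Set V} (h0 : (0 : V) ∈ L) {ρ : V} (hρ : IsNontrivialShift α L ρ)
    (i : Fin (m + 1)) : rootReflection (α i) ρ - ρ ∈ L := by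
  have h1 := hρ.1 _ (Subgroup.subset_closure ⟨i, rfl⟩ : rootReflection (α i) ∈ weylGroup α)
  have h2 : rootReflection (α i) ρ ∈ rootReflection (α i) '' ((ρ + ·) '' L) :=
    ⟨ρ, ⟨0, h0, add_zero ρ⟩, rfl⟩
  rw [h1] at h2
  obtain ⟨l, hl, hl'⟩ := h2
  rw [← hl']; simpa using hl

theorem reflection_mem_weylGroup (i : Fin (m + 1)) : rootReflection (α i) ∈ weylGroup α :=
  Subgroup.subset_closure ⟨i, rfl⟩

namespace IsFrame

theorem inner_reflection_simple (h : IsFrame α e κ c) (i : Fin m) (v : V) :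
    ⟪e i.castSucc, rootReflection (α i.castSucc) v⟫_ℝ = ⟪e i.succ, v⟫_ℝ := by
  have := inner_isSigned (reflection_mem_weylGroup _) (h.isSigned_simple i) i.succ v
  rw [Equiv.swap_apply_right] at this
  simpa using this

theorem inner_reflection_last (h : IsFrame α e κ c) (i : Fin (m + 1)) (v : V) :
    ⟪e i, rootReflection (α (Fin.last m)) v⟫_ℝ =
      (if i = Fin.last m then -1 else 1) * ⟪e i, v⟫_ℝ := by
  have := inner_isSigned (reflection_mem_weylGroup _) h.isSigned_last i v
  rw [Equiv.Perm.one_apply] at this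
  rw [this]; split_ifs <;> simp

/-- Invariance under the last reflection makes twice the last scaled coordinate integral; the other
reflections make all coordinates congruent modulo integers. If one were integral, all would be, and
`ρ` would lie in `L`. It serves the weight lattice of type C and the dual weight lattice of type B.
-/
theorem half_of_shift (h : IsFrame α e κ c) {L : Set V} {r : ℝ}
    (hL : ∀ v, v ∈ L ↔ ∀ i, ∃ k : ℤ, r * ⟪e i, v⟫_ℝ = k) {ρ : V} (hρ : IsNontrivialShift α L ρ)
    (i : Fin (m + 1)) : ∃ k : ℤ, r * ⟪e i, ρ⟫_ℝ = k + 1 / 2 := by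
  have h0 : (0 : V) ∈ L := (hL 0).2 fun i => ⟨0, by simp⟩
  obtain ⟨N, hN⟩ : ∃ N : ℤ, 2 * (r * ⟪e (Fin.last m), ρ⟫_ℝ) = N := by
    obtain ⟨k, hk⟩ := (hL _).1 (reflection_sub_mem h0 hρ (Fin.last m)) (Fin.last m)
    rw [inner_sub_right, h.inner_reflection_last, if_pos rfl] at hk
    refine ⟨-k, ?_⟩
    push_cast; linarith
  have hd : ∀ i, ∃ k : ℤ, r * ⟪e i, ρ⟫_ℝ = r * ⟪e (Fin.last m), ρ⟫_ℝ + k := by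
    intro i
    induction i using Fin.reverseInduction with
    | last => exact ⟨0, by simp⟩
    | cast i ih =>
      obtain ⟨k, hk⟩ := ih
      obtain ⟨l, hl⟩ := (hL _).1 (reflection_sub_mem h0 hρ i.castSucc) i.castSucc
      rw [inner_sub_right, h.inner_reflection_simple] at hl
      refine ⟨k - l, ?_⟩
      push_cast; linarith
  rcases Int.even_or_odd' N with ⟨N', rfl | rfl⟩
  · refine absurd ((hL ρ).2 fun i => ?_) hρ.2
    obtain ⟨k, hk⟩ := hd i
    refine ⟨N' + k, ?_⟩
    push_cast at hN ⊢; linarith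
  · obtain ⟨k, hk⟩ := hd i
    refine ⟨N' + k, ?_⟩
    push_cast at hN ⊢; linarith

theorem mem_dualWeightLattice_C (h : IsFrame α e 2 c) (v : V) :
    v ∈ dualWeightLattice α ↔ ∃ u : Fin (m + 1) → ℤ, (∀ i j, u i % 2 = u j % 2) ∧
      ∀ i, 2 * ⟪e i, v⟫_ℝ = u i := by
  have hs : ∀ i : Fin m, ⟪v, α i.castSucc⟫_ℝ = ⟪e i.castSucc, v⟫_ℝ - ⟪e i.succ, v⟫_ℝ := fun i => by
    rw [real_inner_comm, h.simple, inner_sub_left]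
  have hl : ⟪v, α (Fin.last m)⟫_ℝ = 2 * ⟪e (Fin.last m), v⟫_ℝ := by
    rw [real_inner_comm, h.last, inner_smul_left]; simp
  constructor
  · intro hv
    obtain ⟨N, hN⟩ := hv (Fin.last m)
    rw [hl] at hN
    have key : ∀ i, ∃ k : ℤ, 2 * ⟪e i, v⟫_ℝ = k ∧ k % 2 = N % 2 := by
      intro i
      induction i using Fin.reverseInduction with
      | last => exact ⟨N, hN, rfl⟩
      | cast i ih =>
        obtain ⟨k, hk, hk'⟩ := ih
        obtain ⟨l, hl⟩ := hv i.castSucc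
        rw [hs] at hl
        refine ⟨k + 2 * l, ?_, by omega⟩
        push_cast; linarith
    choose u hu using key
    exact ⟨u, fun i j => by rw [(hu i).2, (hu j).2], fun i => (hu i).1⟩
  · rintro ⟨u, hp, hu⟩ i
    induction i using Fin.lastCases with
    | last => exact ⟨_, hl.trans (hu _)⟩
    | cast i =>
      have h1 := hp i.castSucc i.succ
      obtain ⟨k, hk⟩ : ∃ k, u i.castSucc = u i.succ + 2 * k :=
        ⟨(u i.castSucc - u i.succ) / 2, by omega⟩
      refine ⟨k, ?_⟩
      have h2 := hu i.castSucc
      have h3 := hu i.succ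
      rw [hk] at h2
      push_cast at h2
      rw [hs]; linarith

theorem mem_dualWeightLattice_B (h : IsFrame α e 1 c) (v : V) :
    v ∈ dualWeightLattice α ↔ ∀ i, ∃ k : ℤ, 1 * ⟪e i, v⟫_ℝ = k := by
  have hs : ∀ i : Fin m, ⟪v, α i.castSucc⟫_ℝ = ⟪e i.castSucc, v⟫_ℝ - ⟪e i.succ, v⟫_ℝ := fun i => by
    rw [real_inner_comm, h.simple, inner_sub_left]
  have hl : ⟪v, α (Fin.last m)⟫_ℝ = ⟪e (Fin.last m), v⟫_ℝ := by
    rw [real_inner_comm, h.last, one_smul]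
  simp only [one_mul]
  constructor
  · intro hv i
    induction i using Fin.reverseInduction with
    | last => rw [← hl]; exact hv _
    | cast i ih =>
      obtain ⟨k, hk⟩ := ih
      obtain ⟨l, hl⟩ := hv i.castSucc
      rw [hs] at hl
      exact ⟨k + l, by push_cast; linarith⟩
  · intro hv i
    induction i using Fin.lastCases with
    | last => rw [hl]; exact hv _
    | cast i =>
      obtain ⟨k, hk⟩ := hv i.castSucc
      obtain ⟨l, hl⟩ := hv i.succ
      exact ⟨k - l, by rw [hs, hk, hl]; push_cast; ring⟩

theorem mem_weightLattice_C (h : IsFrame α e 2 c) (v : V) :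
    v ∈ weightLattice α ↔ ∀ i, ∃ k : ℤ, c⁻¹ * ⟪e i, v⟫_ℝ = k := by
  have hc := h.pos
  have hs : ∀ i : Fin m, ⟪v, coroot (α i.castSucc)⟫_ℝ =
      c⁻¹ * ⟪e i.castSucc, v⟫_ℝ - c⁻¹ * ⟪e i.succ, v⟫_ℝ := fun i => by
    rw [coroot, real_inner_self_eq_norm_sq, h.norm_simple, inner_smul_right, real_inner_comm,
      h.simple, inner_sub_left]
    field_simp
  have hl : ⟪v, coroot (α (Fin.last m))⟫_ℝ = c⁻¹ * ⟪e (Fin.last m), v⟫_ℝ := by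
    rw [coroot, real_inner_self_eq_norm_sq, h.norm_last, inner_smul_right, real_inner_comm,
      h.last, inner_smul_left]
    simp only [conj_trivial]
    field_simp
  constructor
  · intro hv i
    induction i using Fin.reverseInduction with
    | last => rw [← hl]; exact hv _
    | cast i ih =>
      obtain ⟨k, hk⟩ := ih
      obtain ⟨l, hl⟩ := hv i.castSucc
      rw [hs] at hl
      exact ⟨k + l, by push_cast; linarith⟩
  · intro hv i
    induction i using Fin.lastCases with
    | last => rw [hl]; exact hv _
    | cast i =>
      obtain ⟨k, hk⟩ := hv i.castSucc
      obtain ⟨l, hl⟩ := hv i.succ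
      exact ⟨k - l, by rw [hs, hk, hl]; push_cast; ring⟩

theorem thetaSign_of_shift (h : IsFrame α e 2 c) {ρ : V} (hρ : IsNontrivialAdmissibleDualShift α ρ) :
    ThetaSign α e ρ (-1) := by
  refine h.thetaSign_half fun i => ?_
  obtain ⟨k, hk⟩ := h.half_of_shift h.mem_weightLattice_C hρ i
  exact ⟨k, by rw [← hk, div_eq_inv_mul]⟩

theorem norm_le_iff (h : IsFrame α e κ c) (i j : Fin (m + 1)) :
    ‖α i‖ ≤ ‖α j‖ ↔ (if i = Fin.last m then κ ^ 2 else 2) ≤ (if j = Fin.last m then κ ^ 2 else 2) := by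
  have key : ∀ i, ‖α i‖ ^ 2 = (if i = Fin.last m then κ ^ 2 else 2) * c := by
    intro i
    induction i using Fin.lastCases with
    | last => rw [if_pos rfl, h.norm_last]
    | cast i => rw [if_neg (Fin.castSucc_lt_last i).ne, h.norm_simple]
  rw [← sq_le_sq₀ (norm_nonneg _) (norm_nonneg _), key, key, mul_le_mul_iff_left₀ h.pos]

theorem isLong_C (h : IsFrame α e 2 c) (i : Fin (m + 1)) :
    IsLong α i ↔ i = Fin.last m := by
  simp only [IsLong, h.norm_le_iff]
  constructor
  · intro hi
    by_contra hne
    have := hi (Fin.last m)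
    rw [if_pos rfl, if_neg hne] at this
    norm_num at this
  · rintro rfl j
    rw [if_pos rfl]
    split_ifs <;> norm_num

theorem signPair_s_C (h : IsFrame α e 2 c) : SignPair α .s (-1) 1 :=
  ⟨fun i => if_neg (by rw [h.isLong_C]; exact (Fin.castSucc_lt_last i).ne),
    if_pos ((h.isLong_C _).2 rfl)⟩

theorem signPair_l_C (h : IsFrame α e 2 c) : SignPair α .l 1 (-1) :=
  ⟨fun i => if_neg (by rw [h.isLong_C]; exact (Fin.castSucc_lt_last i).ne),
    if_pos ((h.isLong_C _).2 rfl)⟩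

theorem isLong_castSucc_B (h : IsFrame α e 1 c) (i : Fin m) : IsLong α i.castSucc := by
  intro j
  rw [h.norm_le_iff, if_neg (Fin.castSucc_lt_last i).ne]
  split_ifs <;> norm_num

theorem not_isLong_last_B (h : IsFrame α e 1 c) (i : Fin m) : ¬ IsLong α (Fin.last m) := by
  intro hl
  have := hl i.castSucc
  rw [h.norm_le_iff, if_neg (Fin.castSucc_lt_last i).ne, if_pos rfl] at this
  norm_num at this

theorem encard_eq (h : IsFrame α e κ c) {N : ℝ} (hN : N ≠ 0) {S : Set V}
    {U : Set (Fin (m + 1) → ℤ)} (hS : ∀ a, a ∈ S ↔ ∃ u ∈ U, ∀ i, N * ⟪e i, a⟫_ℝ = u i) :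
    S.encard = U.encard := by
  choose g hg using fun u : Fin (m + 1) → ℤ => h.exists_coords fun i => (u i : ℝ) / N
  have hg' : ∀ u i, N * ⟪e i, g u⟫_ℝ = u i := fun u i => by rw [hg]; field_simp
  have hinj : Function.Injective g := fun u v huv => funext fun i => by
    have := hg' u i
    rw [huv, hg'] at this
    exact_mod_cast this.symm
  have : S = g '' U := by
    ext a
    rw [hS]
    constructor
    · rintro ⟨u, hu, hua⟩
      refine ⟨u, hu, h.ext_inner fun i => ?_⟩
      rw [hg, ← hua]; field_simp
    · rintro ⟨u, hu, rfl⟩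
      exact ⟨u, hu, hg' u⟩
  rw [this, hinj.encard_image]

end IsFrame

theorem mem_grid {M : ℕ} (hM : 0 < M) {σ : SignKind} {ρ ρc a : V} :
    a ∈ grid α σ M ρ ρc ↔ (M : ℝ) • a - ρc ∈ dualWeightLattice α ∧ a ∈ signedDomain α σ ρ := by
  have hM' : (M : ℝ) ≠ 0 := by exact_mod_cast hM.ne'
  refine and_congr ⟨?_, fun hp => ⟨_, hp, ?_⟩⟩ Iff.rfl
  · rintro ⟨p, hp, rfl⟩
    rw [one_div, smul_inv_smul₀ hM']
    simpa using hp
  · rw [add_sub_cancel, one_div, inv_smul_smul₀ hM']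

/-- The scale `K` is separate from `M` because the shifted A₁ grid needs `K = 2M`; elsewhere `K =
M`. The predicate `G` carries the parity condition of the shifted lattice. -/
theorem IsFrame.encard_grid_C (h : IsFrame α e 2 c) {M K : ℕ} (hM : 0 < M) (hK : 0 < K)
    {σ : SignKind} {a b t : ℤˣ} (hσ : SignPair α σ a b) {ρ ρc : V} (ht : ThetaSign α e ρ t)
    {G : (Fin (m + 1) → ℤ) → Prop}
    (hG : ∀ x : V, (M : ℝ) • x - ρc ∈ dualWeightLattice α ↔
      ∃ u, G u ∧ ∀ i, 2 * K * ⟪e i, x⟫_ℝ = u i) :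
    (grid α σ M ρ ρc).encard = {u | G u ∧ Antitone u ∧ (∀ i, 0 ≤ u i ∧ u i ≤ K) ∧
      (a = -1 → StrictAnti u) ∧ (b = -1 → ∀ i, u i ≠ 0) ∧ (b * t = -1 → ∀ i, u i ≠ K)}.encard := by
  have hK' : (0 : ℝ) < K := by exact_mod_cast hK
  refine h.encard_eq (N := 2 * K) (by positivity) fun x => ?_
  have hD : ∀ u : Fin (m + 1) → ℤ, (∀ i, 2 * K * ⟪e i, x⟫_ℝ = u i) → (x ∈ signedDomain α σ ρ ↔
      Antitone u ∧ (∀ i, 0 ≤ u i ∧ u i ≤ K) ∧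
      (a = -1 → StrictAnti u) ∧ (b = -1 → ∀ i, u i ≠ 0) ∧ (b * t = -1 → ∀ i, u i ≠ K)) := by
    intro u hu
    have hx : ∀ i, ⟪e i, x⟫_ℝ = u i / (2 * K) := fun i => by rw [← hu]; field_simp
    rw [h.mem_signedDomain_C hσ ht]
    have e1 : Antitone (fun i => ⟪e i, x⟫_ℝ) ↔ Antitone u := by
      refine forall₃_congr fun i j _ => ?_
      simp only [hx]
      rw [div_le_div_iff_of_pos_right (by positivity), Int.cast_le]
    have e2 : StrictAnti (fun i => ⟪e i, x⟫_ℝ) ↔ StrictAnti u := by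
      refine forall₃_congr fun i j _ => ?_
      simp only [hx]
      rw [div_lt_div_iff_of_pos_right (by positivity), Int.cast_lt]
    have e3 : ∀ i, 0 ≤ ⟪e i, x⟫_ℝ ↔ 0 ≤ u i := fun i => by
      rw [hx, le_div_iff₀ (by positivity), zero_mul, Int.cast_nonneg_iff]
    have e4 : ∀ i, 2 * ⟪e i, x⟫_ℝ = ((u i : ℤ) : ℝ) / ((K : ℤ) : ℝ) := fun i => by
      rw [hx]; push_cast; field_simp
    have hKz : (0 : ℝ) < ((K : ℤ) : ℝ) := by exact_mod_cast hK
    have e5 : ∀ i, 2 * ⟪e i, x⟫_ℝ ≤ 1 ↔ u i ≤ K := fun i => by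
      rw [e4, div_le_one hKz, Int.cast_le]
    have e6 : ∀ i, 2 * ⟪e i, x⟫_ℝ = 1 ↔ u i = K := fun i => by
      rw [e4, div_eq_one_iff_eq hKz.ne', Int.cast_inj]
    have e7 : ∀ i, ⟪e i, x⟫_ℝ = 0 ↔ u i = 0 := fun i => by
      rw [hx, div_eq_zero_iff, or_iff_left (by positivity), Int.cast_eq_zero]
    simp only [e1, e2, e3, e5, Ne, e6, e7]
  rw [mem_grid hM, hG]
  constructor
  · rintro ⟨⟨u, hu, hux⟩, hx⟩
    exact ⟨u, ⟨hu, (hD u hux).1 hx⟩, hux⟩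
  · rintro ⟨u, ⟨hu, hd⟩, hux⟩
    exact ⟨⟨u, hu, hux⟩, (hD u hux).2 hd⟩

end Lattices

/-! ### Unshifted grids of type C with a nontrivial dual shift -/

section TypeC

variable {V : Type*} [NormedAddCommGroup V] [InnerProductSpace ℝ V] {m : ℕ}
variable {α : Module.Basis (Fin (m + 1)) ℝ V} {e : Fin (m + 1) → V} {c : ℝ}

namespace IsFrame

theorem unshifted_iff (h : IsFrame α e 2 c) (M : ℕ) (x : V) :
    (M : ℝ) • x - 0 ∈ dualWeightLattice α ↔
      ∃ u : Fin (m + 1) → ℤ, (∀ i j, u i % 2 = u j % 2) ∧ ∀ i, 2 * M * ⟪e i, x⟫_ℝ = u i := by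
  rw [h.mem_dualWeightLattice_C]
  simp only [sub_zero, inner_smul_right, mul_assoc]

/-- If `ρ` is a nontrivial dual shift and `σ` is `1` on the short simple reflections, the grid
corresponds to weakly decreasing tuples of constant parity. -/
theorem encard_grid_weak (h : IsFrame α e 2 c) {M : ℕ} (hM : 0 < M) {σ : SignKind} {b : ℤˣ}
    (hσ : SignPair α σ 1 b) {ρ : V} (hρ : IsNontrivialAdmissibleDualShift α ρ) :
    (grid α σ M ρ 0).encard = nu (m + 1) (M - 1) := by
  -- With `t = -1`, `b = 1` forbids the endpoint `M` and leaves `[0, M)`, while `b = -1` forbids `0`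
  -- and leaves `[1, M]`: `M` integers either way.
  rw [h.encard_grid_C hM hM hσ (h.thetaSign_of_shift hρ) (h.unshifted_iff M), nu_weak m M hM,
    ← encard_antitone_parity m (if b = 1 then 0 else 1) M]
  congr 1
  ext u
  simp only [Set.mem_ofPred_eq]
  rcases Int.units_eq_one_or b with rfl | rfl
  · simp only [if_true, one_mul, forall_const, Nat.cast_zero, zero_add]
    constructor
    · rintro ⟨hp, ha, hu, -, -, h2⟩
      exact ⟨ha, fun i => ⟨(hu i).1, lt_of_le_of_ne (hu i).2 (h2 i)⟩, hp⟩
    · rintro ⟨ha, hu, hp⟩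
      exact ⟨hp, ha, fun i => ⟨(hu i).1, (hu i).2.le⟩, fun h => absurd h (by decide),
        fun h => absurd h (by decide), fun i => (hu i).2.ne⟩
  · rw [if_neg (by decide)]
    constructor
    · rintro ⟨hp, ha, hu, -, h2, -⟩
      refine ⟨ha, fun i => ?_, hp⟩
      have := hu i; have := h2 rfl i
      push_cast; omega
    · rintro ⟨ha, hu, hp⟩
      refine ⟨hp, ha, fun i => ?_, fun h => absurd h (by decide), fun _ i => ?_,
        fun h => absurd h (by decide)⟩ <;> have := hu i <;> push_cast at this <;> omega

/-- If `ρ` is a nontrivial dual shift and `σ` is `-1` on the short simple reflections, the grid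
corresponds to strictly decreasing tuples of constant parity. -/
theorem encard_grid_strict (h : IsFrame α e 2 c) {M : ℕ} (hM : 0 < M) {σ : SignKind} {b : ℤˣ}
    (hσ : SignPair α σ (-1) b) {ρ : V} (hρ : IsNontrivialAdmissibleDualShift α ρ) :
    (grid α σ M ρ 0).encard = nu (m + 1) (M - 2 * (m + 1 : ℕ) + 1) := by
  rw [h.encard_grid_C hM hM hσ (h.thetaSign_of_shift hρ) (h.unshifted_iff M), nu_strict _ M hM,
    ← encard_strictAnti_parity m (if b = 1 then 0 else 1) M]
  congr 1
  ext u
  simp only [Set.mem_ofPred_eq]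
  rcases Int.units_eq_one_or b with rfl | rfl
  · simp only [if_true, one_mul, Nat.cast_zero, zero_add]
    constructor
    · rintro ⟨hp, ha, hu, hs, -, h2⟩
      exact ⟨hs trivial, fun i => ⟨(hu i).1, lt_of_le_of_ne (hu i).2 (h2 trivial i)⟩, hp⟩
    · rintro ⟨ha, hu, hp⟩
      exact ⟨hp, ha.antitone, fun i => ⟨(hu i).1, (hu i).2.le⟩, fun _ => ha,
        fun h => absurd h (by decide), fun _ i => (hu i).2.ne⟩
  · rw [if_neg (by decide)]
    constructor
    · rintro ⟨hp, ha, hu, hs, h2, -⟩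
      refine ⟨hs trivial, fun i => ?_, hp⟩
      have := hu i; have := h2 rfl i
      push_cast; omega
    · rintro ⟨ha, hu, hp⟩
      refine ⟨hp, ha.antitone, fun i => ?_, fun _ => ha, fun _ i => ?_,
        fun h => absurd h (by decide)⟩ <;> have := hu i <;> push_cast at this <;> omega

end IsFrame

end TypeC

/-! ### Shifted grids of types `A₁` and `C₂` -/

section SmallRank

variable {V : Type*} [NormedAddCommGroup V] [InnerProductSpace ℝ V]

/-- In rank one the lattice is `2x ∈ ℤ`, so a nontrivial shift has `4x` odd. -/
theorem shifted_iff_A (α : Module.Basis (Fin 1) ℝ V) {e : Fin 1 → V} {c : ℝ}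
    (h : IsFrame α e 2 c) {ρc : V} (hρ : IsNontrivialAdmissibleShift α ρc) (M : ℕ) (x : V) :
    (M : ℝ) • x - ρc ∈ dualWeightLattice α ↔
      ∃ u : Fin 1 → ℤ, (∀ i, u i % 2 = (1 : ℕ)) ∧ ∀ i, 2 * (2 * M : ℕ) * ⟪e i, x⟫_ℝ = u i := by
  have hL : ∀ v, v ∈ dualWeightLattice α ↔ ∃ k : ℤ, 2 * ⟪e 0, v⟫_ℝ = k := by
    intro v
    rw [h.mem_dualWeightLattice_C]
    constructor
    · rintro ⟨u, -, hu⟩; exact ⟨u 0, hu 0⟩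
    · rintro ⟨k, hk⟩
      exact ⟨fun _ => k, fun _ _ => rfl, fun i => by rw [Fin.fin_one_eq_zero i]; exact hk⟩
  obtain ⟨N, hN, hN2⟩ : ∃ N : ℤ, 4 * ⟪e 0, ρc⟫_ℝ = N ∧ N % 2 = 1 := by
    have h0 : (0 : V) ∈ dualWeightLattice α := (hL 0).2 ⟨0, by simp⟩
    obtain ⟨k, hk⟩ := (hL _).1 (reflection_sub_mem h0 hρ (Fin.last 0))
    rw [inner_sub_right, h.inner_reflection_last, if_pos (by decide)] at hk
    refine ⟨-k, by push_cast; linarith, ?_⟩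
    by_contra hk2
    obtain ⟨l, hl⟩ : ∃ l, k = 2 * l := ⟨k / 2, by omega⟩
    refine hρ.2 ((hL _).2 ⟨-l, ?_⟩)
    rw [hl] at hk
    push_cast at hk ⊢; linarith
  rw [hL, inner_sub_right, inner_smul_right]
  constructor
  · rintro ⟨k, hk⟩
    refine ⟨fun _ => 2 * k + N, fun _ => by push_cast; omega, fun i => ?_⟩
    rw [Subsingleton.elim i 0]
    push_cast; linarith
  · rintro ⟨u, hu, hux⟩
    have h1 := hu 0
    have h2 := hux 0
    obtain ⟨k, hk⟩ : ∃ k, u 0 = 2 * k + N := ⟨(u 0 - N) / 2, by push_cast at h1; omega⟩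
    refine ⟨k, ?_⟩
    rw [hk] at h2
    push_cast at h2; linarith

theorem encard_grid_A (α : Module.Basis (Fin 1) ℝ V) {e : Fin 1 → V} {c : ℝ}
    (h : IsFrame α e 2 c) {ρc : V} (hρc : IsNontrivialAdmissibleShift α ρc) {M : ℕ} (hM : 0 < M)
    {σ : SignKind} {a b t : ℤˣ} (hσ : SignPair α σ a b) {ρ : V} (ht : ThetaSign α e ρ t) :
    (grid α σ M ρ ρc).encard = M := by
  rw [h.encard_grid_C hM (K := 2 * M) (by omega) hσ ht (shifted_iff_A α h hρc M)]
  -- Odd numbers in `[0, 2M]`: the endpoints are even, so no boundary condition has any effect.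
  have hcard := encard_antitone_mod 0 0 (2 * M + 1) 1 (by norm_num)
  rw [if_neg (by norm_num), Nat.choose_one_right,
    show (2 * M + 1 + 2 * 0) / 2 = M by omega] at hcard
  rw [← hcard]
  congr 1
  ext u
  simp only [Set.mem_ofPred_eq]
  constructor
  · rintro ⟨hp, ha, hu, -⟩
    refine ⟨ha, fun i => ⟨?_, hp i⟩⟩
    have := hu i
    push_cast at this ⊢; omega
  · rintro ⟨ha, hu⟩
    refine ⟨fun i => (hu i).2, ha, fun i => ?_, fun _ => Subsingleton.strictAnti (α := Fin 1) u, fun _ i => ?_,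
      fun _ i => ?_⟩ <;> have := hu i <;> push_cast at this ⊢ <;> omega

/-- The doubled coordinates of the shift turn out to be integers; they have opposite parity, since
equal parity would put the shift in the lattice. -/
theorem shifted_iff_C (α : Module.Basis (Fin 2) ℝ V) {e : Fin 2 → V} {c : ℝ}
    (h : IsFrame α e 2 c) {ρc : V} (hρ : IsNontrivialAdmissibleShift α ρc) (M : ℕ) (x : V) :
    (M : ℝ) • x - ρc ∈ dualWeightLattice α ↔
      ∃ u : Fin 2 → ℤ, (u 0 + u 1) % 2 = 1 ∧ ∀ i, 2 * M * ⟪e i, x⟫_ℝ = u i := by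
  have hL : ∀ v, v ∈ dualWeightLattice α ↔ ∃ k l : ℤ, k % 2 = l % 2 ∧ 2 * ⟪e 0, v⟫_ℝ = k ∧
      2 * ⟪e 1, v⟫_ℝ = l := by
    intro v
    rw [h.mem_dualWeightLattice_C]
    constructor
    · rintro ⟨u, hp, hu⟩; exact ⟨u 0, u 1, hp 0 1, hu 0, hu 1⟩
    · rintro ⟨k, l, hkl, hk, hl⟩
      refine ⟨![k, l], ?_, ?_⟩
      · intro i j; fin_cases i <;> fin_cases j <;> simp [hkl]
      · intro i; fin_cases i <;> simp [hk, hl]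
  have h0 : (0 : V) ∈ dualWeightLattice α := (hL 0).2 ⟨0, 0, rfl, by simp, by simp⟩
  obtain ⟨N, hN⟩ : ∃ N : ℤ, 2 * ⟪e 1, ρc⟫_ℝ = N := by
    obtain ⟨k, l, hkl, hk, hl⟩ := (hL _).1 (reflection_sub_mem h0 hρ (Fin.last 1))
    rw [inner_sub_right, h.inner_reflection_last, if_neg (by decide)] at hk
    rw [inner_sub_right, h.inner_reflection_last, if_pos (by decide)] at hl
    -- The last reflection fixes the first coordinate, so the difference is `(0, l)` in doubled
    -- coordinates, and the parity condition makes `l` even.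
    have hk0 : k = 0 := by
      have : (k : ℝ) = 0 := by linarith
      exact_mod_cast this
    obtain ⟨j, rfl⟩ : ∃ j, l = 2 * j := ⟨l / 2, by omega⟩
    exact ⟨-j, by push_cast at hl ⊢; linarith⟩
  obtain ⟨N', hN'⟩ : ∃ N : ℤ, 2 * ⟪e 0, ρc⟫_ℝ = N := by
    obtain ⟨k, l, hkl, hk, hl⟩ := (hL _).1 (reflection_sub_mem h0 hρ (Fin.castSucc 0))
    have := h.inner_reflection_simple 0 ρc
    rw [Fin.castSucc_zero, Fin.succ_zero_eq_one] at this
    rw [inner_sub_right, Fin.castSucc_zero, this] at hk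
    exact ⟨N - k, by push_cast; linarith⟩
  have hodd : (N + N') % 2 = 1 := by
    by_contra hne
    exact hρ.2 ((hL _).2 ⟨N', N, by omega, hN', hN⟩)
  rw [hL, inner_sub_right, inner_smul_right, inner_sub_right, inner_smul_right]
  constructor
  · rintro ⟨k, l, hkl, hk, hl⟩
    refine ⟨![k + N', l + N], by simp; omega, fun i => ?_⟩
    fin_cases i <;> simp <;> linarith
  · rintro ⟨u, hu, hux⟩
    refine ⟨u 0 - N', u 1 - N, by omega, ?_, ?_⟩
    · have := hux 0; push_cast; linarith
    · have := hux 1; push_cast; linarith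

theorem nu_two (K : ℕ) : nu 2 (K - 2) = ((K + 1) / 2) * (K / 2) := by
  have hch : ∀ k : ℕ, (k + 1).choose 2 * 2 = (k + 1) * k := fun k => by
    rw [Nat.choose_two_right, Nat.add_sub_cancel]
    exact Nat.div_mul_cancel (by rw [mul_comm]; exact (Nat.even_mul_succ_self k).two_dvd)
  unfold nu
  rcases Nat.even_or_odd' K with ⟨k, rfl | rfl⟩
  · rw [if_pos (by rw [Int.even_iff]; push_cast; omega)]
    have h1 : ((2 : ℕ) + (((2 * k : ℕ) : ℤ) - 2) / 2).toNat = k + 1 := by push_cast; omega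
    have h2 : ((2 : ℕ) + (((2 * k : ℕ) : ℤ) - 2) / 2 - 1).toNat = k := by push_cast; omega
    rw [h1, h2, show (2 * k + 1) / 2 = k by omega, show 2 * k / 2 = k by omega]
    rcases k with _ | k
    · rfl
    · have := hch k; have := hch (k + 1)
      nlinarith
  · rw [if_neg (by rw [Int.even_iff]; push_cast; omega)]
    have h1 : ((2 : ℕ) + (((2 * k + 1 : ℕ) : ℤ) - 2) / 2).toNat = k + 1 := by push_cast; omega
    rw [h1, show (2 * k + 1 + 1) / 2 = k + 1 by omega, show (2 * k + 1) / 2 = k by omega, ← hch k,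
      mul_comm]

/-- Entries of opposite parity are never equal, so `a` plays no role; only the interval left by the
two endpoint conditions matters. -/
theorem encard_grid_mixed (α : Module.Basis (Fin 2) ℝ V) {e : Fin 2 → V} {c : ℝ}
    (h : IsFrame α e 2 c) {ρc : V} (hρc : IsNontrivialAdmissibleShift α ρc) {M : ℕ} (hM : 0 < M)
    {σ : SignKind} {a b t : ℤˣ} (hσ : SignPair α σ a b) {ρ : V} (ht : ThetaSign α e ρ t)
    {lo len : ℕ}
    (hJ : ∀ s : ℤ, (0 ≤ s ∧ s ≤ M) ∧ (b = -1 → s ≠ 0) ∧ (b * t = -1 → s ≠ M) ↔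
      lo ≤ s ∧ s < lo + len) :
    (grid α σ M ρ ρc).encard = nu 2 (len - 2) := by
  rw [h.encard_grid_C hM hM hσ ht (shifted_iff_C α h hρc M), nu_two, ← encard_pair_mixed lo len]
  congr 1
  ext u
  simp only [Set.mem_ofPred_eq]
  constructor
  · rintro ⟨hp, ha, hu, -, h1, h2⟩
    exact ⟨ha, fun i => (hJ _).1 ⟨hu i, fun hb => h1 hb i, fun hb => h2 hb i⟩, hp⟩
  · rintro ⟨ha, hu, hp⟩
    have := fun i => (hJ _).2 (hu i)
    refine ⟨hp, ha, fun i => (this i).1, fun _ => ?_, fun hb i => (this i).2.1 hb,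
      fun hb i => (this i).2.2 hb⟩
    rw [Fin.strictAnti_iff_succ_lt]
    intro i
    rw [Subsingleton.elim i 0]
    refine lt_of_le_of_ne (ha (Fin.castSucc_lt_succ).le) fun heq => ?_
    have heq : u 1 = u 0 := heq
    omega

end SmallRank

/-! ### Type `B` -/

section TypeB

/-- Reflecting `u 0` in `M` exchanges the walls `u 0 = u 1` and `u 0 + u 1 = 2M` (the symmetry of
the affine B diagram). Tuples with `u 0 ≤ M` are kept, the others are reflected. -/
theorem encard_reflected (m M : ℕ) (s : Prop) :
    {u : Fin (m + 1 + 1) → ℤ | (∀ i, u i % 2 = 1) ∧ Antitone u ∧ (∀ i, 0 ≤ u i) ∧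
      u 0 + u 1 ≤ 2 * M ∧ (s → StrictAnti u ∧ u 0 + u 1 ≠ 2 * M)}.encard =
    {u : Fin (m + 1 + 1) → ℤ | (Antitone u ∧ (s → StrictAnti u)) ∧
      ∀ i, ((1 : ℕ) ≤ u i ∧ u i < (1 : ℕ) + (M : ℕ)) ∧ u i % 2 = (1 : ℕ)}.encard +
    {u : Fin (m + 1 + 1) → ℤ | (Antitone u ∧ (s → StrictAnti u)) ∧
      ∀ i, ((1 : ℕ) ≤ u i ∧ u i < (1 : ℕ) + ((M - 1 : ℕ) : ℤ)) ∧ u i % 2 = (1 : ℕ)}.encard := by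
  let φ : (Fin (m + 1 + 1) → ℤ) → (Fin (m + 1 + 1) → ℤ) := fun u => Function.update u 0 (2 * M - u 0)
  have φ0 : ∀ u, φ u 0 = 2 * M - u 0 := fun u => by simp [φ]
  have φs : ∀ u i, i ≠ 0 → φ u i = u i := fun u i hi => by simp [φ, hi]
  have hφφ : ∀ u, φ (φ u) = u := fun u => by ext i; simp [φ]
  have anti : ∀ u : Fin (m + 1 + 1) → ℤ, Antitone u → u 1 ≤ 2 * M - u 0 → Antitone (φ u) := by
    intro u hu h1 i j hij
    by_cases hi : i = 0
    · subst hi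
      by_cases hj : j = 0
      · rw [hj]
      · rw [φ0, φs u j hj]
        exact (hu (Fin.one_le_of_ne_zero hj)).trans h1
    · have hj : j ≠ 0 := fun hj => hi (le_antisymm (hj ▸ hij) (Fin.zero_le _))
      rw [φs u i hi, φs u j hj]; exact hu hij
  have strict : ∀ u : Fin (m + 1 + 1) → ℤ, StrictAnti u → u 1 < 2 * M - u 0 → StrictAnti (φ u) := by
    intro u hu h1 i j hij
    have hj : j ≠ 0 := Fin.ne_zero_of_lt hij
    by_cases hi : i = 0
    · subst hi
      rw [φ0, φs u j hj]
      exact (hu.antitone (Fin.one_le_of_ne_zero hj)).trans_lt h1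
    · rw [φs u i hi, φs u j hj]; exact hu hij
  have h10 : (1 : Fin (m + 1 + 1)) ≠ 0 := by simp
  rw [← (Function.LeftInverse.injective hφφ).encard_image {u : Fin (m + 1 + 1) → ℤ |
    (Antitone u ∧ (s → StrictAnti u)) ∧
      ∀ i, ((1 : ℕ) ≤ u i ∧ u i < (1 : ℕ) + ((M - 1 : ℕ) : ℤ)) ∧ u i % 2 = (1 : ℕ)},
    ← Set.encard_union_eq]
  · congr 1
    ext u
    simp only [Set.mem_union, Set.mem_image, Set.mem_ofPred_eq]
    constructor
    · rintro ⟨hp, ha, hu, h1, hs⟩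
      have hle : ∀ i, u i ≤ u 0 := fun i => ha (Fin.zero_le i)
      by_cases h0 : u 0 ≤ M
      · refine Or.inl ⟨⟨ha, fun h => (hs h).1⟩, fun i => ?_⟩
        have := hp i; have := hu i; have := hle i
        push_cast; omega
      -- Here `u 0 > M`, so the reflected first entry is at most `M - 1`; strictness of the
      -- reflected tuple uses exactly that `u` avoids the wall `u 0 + u 1 = 2M`.
      · have ha' := anti u ha (by linarith)
        refine Or.inr ⟨φ u, ⟨⟨ha', fun h => strict u (hs h).1 ?_⟩, fun i => ?_⟩, hφφ u⟩
        · have := (hs h).2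
          omega
        · have l0 := ha' (Fin.zero_le i)
          rw [φ0] at l0
          by_cases hi : i = 0
          · subst hi
            rw [φ0]
            have := hp 0; have := hp 1; have := hu 1; push_cast; omega
          · rw [φs u i hi] at l0 ⊢
            have := hp i; have := hu i; push_cast; omega
    · rintro (⟨⟨ha, hs⟩, hu⟩ | ⟨v, ⟨⟨ha, hs⟩, hv⟩, rfl⟩)
      · have l0 := hu 0
        have l1 := hu 1
        refine ⟨fun i => by simpa using (hu i).2, ha, fun i => ?_, ?_, fun h => ⟨hs h, ?_⟩⟩
        · have := hu i; push_cast at this; omega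
        · push_cast at l0 l1; omega
        · have : u 1 < u 0 := hs h (by simp)
          push_cast at l0 l1; omega
      · have l0 := hv 0
        have l1 := hv 1
        have l01 : v 1 ≤ v 0 := ha (Fin.zero_le _)
        push_cast at l0 l1
        refine ⟨fun i => ?_, anti v ha (by omega), fun i => ?_, ?_,
          fun h => ⟨strict v (hs h) (by omega), ?_⟩⟩
        · by_cases hi : i = 0
          · subst hi; rw [φ0]; omega
          · rw [φs v i hi]; simpa using (hv i).2
        · by_cases hi : i = 0
          · subst hi; rw [φ0]; omega
          · rw [φs v i hi]; have := hv i; push_cast at this; omega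
        · rw [φ0, φs v 1 h10]; omega
        · have : v 1 < v 0 := hs h (by simp)
          rw [φ0, φs v 1 h10]; omega
  · rw [Set.disjoint_left]
    rintro u ⟨-, hu⟩ ⟨v, ⟨-, hv⟩, rfl⟩
    have l0 := hu 0
    have l1 := hv 0
    rw [φ0] at l0
    push_cast at l0 l1
    omega

variable {V : Type*} [NormedAddCommGroup V] [InnerProductSpace ℝ V] {m : ℕ}
variable {α : Module.Basis (Fin (m + 1 + 1)) ℝ V} {e : Fin (m + 1 + 1) → V} {c : ℝ}

namespace IsFrame

theorem shifted_iff_B (h : IsFrame α e 1 c) {ρc : V} (hρ : IsNontrivialAdmissibleShift α ρc)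
    (M : ℕ) (x : V) :
    (M : ℝ) • x - ρc ∈ dualWeightLattice α ↔
      ∃ u : Fin (m + 1 + 1) → ℤ, (∀ i, u i % 2 = 1) ∧ ∀ i, 2 * M * ⟪e i, x⟫_ℝ = u i := by
  choose k hk using h.half_of_shift h.mem_dualWeightLattice_B hρ
  rw [h.mem_dualWeightLattice_B]
  simp only [inner_sub_right, inner_smul_right, one_mul] at hk ⊢
  constructor
  · intro hx
    choose l hl using hx
    refine ⟨fun i => 2 * (l i + k i) + 1, fun i => by dsimp only; omega, fun i => ?_⟩
    have h1 := hk i; have h2 := hl i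
    push_cast; linarith
  · rintro ⟨u, hp, hu⟩ i
    have h1 := hk i; have h2 := hu i; have h3 := hp i
    obtain ⟨j, hj⟩ : ∃ j, u i = 2 * j + 1 := ⟨u i / 2, by omega⟩
    rw [hj] at h2
    refine ⟨j - k i, ?_⟩
    push_cast at h2 ⊢; linarith

theorem encard_grid_B (h : IsFrame α e 1 c) {M : ℕ} (hM : 0 < M) {σ : SignKind} {a b : ℤˣ}
    (hσ : SignPair α σ a b) {ρc : V} (hρ : IsNontrivialAdmissibleShift α ρc) :
    (grid α σ M 0 ρc).encard = {u : Fin (m + 1 + 1) → ℤ | (∀ i, u i % 2 = 1) ∧ Antitone u ∧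
      (∀ i, 0 ≤ u i) ∧ u 0 + u 1 ≤ 2 * M ∧
      (a = -1 → StrictAnti u ∧ u 0 + u 1 ≠ 2 * M)}.encard := by
  have hM' : (0 : ℝ) < M := by exact_mod_cast hM
  refine h.encard_eq (N := 2 * M) (by positivity) fun x => ?_
  have hD : ∀ u : Fin (m + 1 + 1) → ℤ, (∀ i, u i % 2 = 1) → (∀ i, 2 * M * ⟪e i, x⟫_ℝ = u i) →
      (x ∈ signedDomain α σ 0 ↔ Antitone u ∧ (∀ i, 0 ≤ u i) ∧ u 0 + u 1 ≤ 2 * M ∧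
        (a = -1 → StrictAnti u ∧ u 0 + u 1 ≠ 2 * M)) := by
    intro u hp hu
    have hx : ∀ i, ⟪e i, x⟫_ℝ = u i / (2 * M) := fun i => by rw [← hu]; field_simp
    have e0 : ∀ i, ⟪e i, x⟫_ℝ ≠ 0 := fun i h0 => by
      have h1 := hu i
      rw [h0, mul_zero] at h1
      have h2 : u i = 0 := by exact_mod_cast h1.symm
      have := hp i; omega
    rw [h.mem_signedDomain_B hσ e0]
    have e1 : Antitone (fun i => ⟪e i, x⟫_ℝ) ↔ Antitone u := by
      refine forall₃_congr fun i j _ => ?_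
      simp only [hx]
      rw [div_le_div_iff_of_pos_right (by positivity), Int.cast_le]
    have e2 : StrictAnti (fun i => ⟪e i, x⟫_ℝ) ↔ StrictAnti u := by
      refine forall₃_congr fun i j _ => ?_
      simp only [hx]
      rw [div_lt_div_iff_of_pos_right (by positivity), Int.cast_lt]
    have e3 : ∀ i, 0 ≤ ⟪e i, x⟫_ℝ ↔ 0 ≤ u i := fun i => by
      rw [hx, le_div_iff₀ (by positivity), zero_mul, Int.cast_nonneg_iff]
    have e4 : ⟪e 0, x⟫_ℝ + ⟪e 1, x⟫_ℝ = ((u 0 + u 1 : ℤ) : ℝ) / ((2 * M : ℤ) : ℝ) := by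
      rw [hx, hx]; push_cast; field_simp
    have hMz : (0 : ℝ) < ((2 * M : ℤ) : ℝ) := by exact_mod_cast (by omega : 0 < 2 * (M : ℤ))
    rw [e1, e2, e4, div_le_one hMz, Int.cast_le, Ne, div_eq_one_iff_eq hMz.ne', Int.cast_inj]
    simp only [e3, Ne]
  rw [mem_grid hM, h.shifted_iff_B hρ]
  constructor
  · rintro ⟨⟨u, hu, hux⟩, hx⟩
    exact ⟨u, ⟨hu, (hD u hu hux).1 hx⟩, hux⟩
  · rintro ⟨u, ⟨hu, hd⟩, hux⟩
    exact ⟨⟨u, hu, hux⟩, (hD u hu hux).2 hd⟩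

theorem encard_grid_B_weak (h : IsFrame α e 1 c) {M : ℕ} (hM : 0 < M) {σ : SignKind} {b : ℤˣ}
    (hσ : SignPair α σ 1 b) {ρc : V} (hρ : IsNontrivialAdmissibleShift α ρc) :
    (grid α σ M 0 ρc).encard = nu (m + 1 + 1) (M - 1) := by
  rw [h.encard_grid_B hM hσ hρ, encard_reflected]
  have ha : ∀ u : Fin (m + 1 + 1) → ℤ,
      (Antitone u ∧ ((1 : ℤˣ) = -1 → StrictAnti u)) ↔ Antitone u :=
    fun u => and_iff_left fun h => absurd h (by decide)
  simp only [ha]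
  -- Both intervals start at the odd number 1; their lengths `M` and `M - 1` produce the two
  -- binomials of `nu_weak`.
  rw [encard_antitone_mod _ _ _ 1 one_lt_two, encard_antitone_mod _ _ _ 1 one_lt_two,
    if_pos rfl, if_pos rfl, nu_weak _ M hM,
    show M - 1 + 2 * (m + 1) + 1 = M + 2 * (m + 1) by omega]
  push_cast; rfl

theorem encard_grid_B_strict (h : IsFrame α e 1 c) {M : ℕ} (hM : 0 < M) {σ : SignKind} {b : ℤˣ}
    (hσ : SignPair α σ (-1) b) {ρc : V} (hρ : IsNontrivialAdmissibleShift α ρc) :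
    (grid α σ M 0 ρc).encard = nu (m + 1 + 1) (M - 2 * (m + 1 + 1 : ℕ) + 1) := by
  rw [h.encard_grid_B hM hσ hρ, encard_reflected]
  have ha : ∀ u : Fin (m + 1 + 1) → ℤ,
      (Antitone u ∧ StrictAnti u) ↔ StrictAnti u :=
    fun u => and_iff_right_of_imp StrictAnti.antitone
  simp only [forall_const, ha]
  rw [encard_strictAnti_mod _ _ _ 1 one_lt_two, encard_strictAnti_mod _ _ _ 1 one_lt_two,
    if_pos rfl, if_pos rfl, nu_strict _ M hM, show M - 1 + 1 = M by omega]
  push_cast; rfl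

theorem signPair_s_B (h : IsFrame α e 1 c) : SignPair α .s 1 (-1) :=
  ⟨fun i => if_pos (h.isLong_castSucc_B i), if_neg (h.not_isLong_last_B 0)⟩

theorem signPair_l_B (h : IsFrame α e 1 c) : SignPair α .l (-1) 1 :=
  ⟨fun i => if_pos (h.isLong_castSucc_B i), if_neg (h.not_isLong_last_B 0)⟩

end IsFrame

end TypeB

end OrbitGrid

/-! ### Assembly of the four types -/

open OrbitGrid
theorem mainTheorem3 {V : Type*} [NormedAddCommGroup V] [InnerProductSpace ℝ V]
    (M : ℕ) (hM : 0 < M) :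
    -- type A_1
    (∀ α : Module.Basis (Fin 1) ℝ V, HasCartanMatrix α (CartanMatrix.A 1) →
      ∀ ρc ρ : V, IsNontrivialAdmissibleShift α ρc → IsNontrivialAdmissibleDualShift α ρ →
        (grid α .one M ρ 0).encard = M ∧
        (grid α .one M 0 ρc).encard = M ∧
        (grid α .one M ρ ρc).encard = M ∧
        (grid α .e M ρ 0).encard = M ∧
        (grid α .e M 0 ρc).encard = M ∧
        (grid α .e M ρ ρc).encard = M) ∧
    -- type C_2
    (∀ α : Module.Basis (Fin 2) ℝ V, HasCartanMatrix α (CartanMatrix.C 2) →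
      ∀ ρc ρ : V, IsNontrivialAdmissibleShift α ρc → IsNontrivialAdmissibleDualShift α ρ →
        ((grid α .one M ρ 0).encard = nu 2 (M - 1) ∧
          (grid α .one M 0 ρc).encard = nu 2 (M - 1) ∧
          (grid α .s M 0 ρc).encard = nu 2 (M - 1) ∧
          (grid α .l M ρ 0).encard = nu 2 (M - 1)) ∧
        ((grid α .one M ρ ρc).encard = nu 2 (M - 2) ∧
          (grid α .e M ρ ρc).encard = nu 2 (M - 2) ∧
          (grid α .s M ρ ρc).encard = nu 2 (M - 2) ∧
          (grid α .l M ρ ρc).encard = nu 2 (M - 2)) ∧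
        ((grid α .e M 0 ρc).encard = nu 2 (M - 3) ∧
          (grid α .e M ρ 0).encard = nu 2 (M - 3) ∧
          (grid α .s M ρ 0).encard = nu 2 (M - 3) ∧
          (grid α .l M 0 ρc).encard = nu 2 (M - 3))) ∧
    -- type C_n, n ≥ 3
    (∀ n : ℕ, 3 ≤ n → ∀ α : Module.Basis (Fin n) ℝ V, HasCartanMatrix α (CartanMatrix.C n) →
      ∀ ρ : V, IsNontrivialAdmissibleDualShift α ρ →
        ((grid α .one M ρ 0).encard = nu n (M - 1) ∧
          (grid α .l M ρ 0).encard = nu n (M - 1)) ∧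
        ((grid α .e M ρ 0).encard = nu n (M - 2 * n + 1) ∧
          (grid α .s M ρ 0).encard = nu n (M - 2 * n + 1))) ∧
    -- type B_n, n ≥ 3
    (∀ n : ℕ, 3 ≤ n → ∀ α : Module.Basis (Fin n) ℝ V, HasCartanMatrix α (CartanMatrix.B n) →
      ∀ ρc : V, IsNontrivialAdmissibleShift α ρc →
        ((grid α .one M 0 ρc).encard = nu n (M - 1) ∧
          (grid α .s M 0 ρc).encard = nu n (M - 1)) ∧
        ((grid α .e M 0 ρc).encard = nu n (M - 2 * n + 1) ∧
          (grid α .l M 0 ρc).encard = nu n (M - 2 * n + 1))) := by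
  refine ⟨?_, ?_, ?_, ?_⟩
  · intro α hα ρc ρ hρc hρ
    -- A₁ is treated as C₁, whose only simple root counts as the last one, `2 e 0`.
    rw [← CartanMatrix.C_one] at hα
    obtain ⟨e, c, h⟩ := exists_isFrame_C (m := 0) α hα
    have h0 := thetaSign_zero (α := α) (e := e)
    have h1 := h.thetaSign_of_shift hρ
    have hw : nu (0 + 1) (M - 1) = M := by
      rw [nu_weak 0 M hM, Nat.choose_one_right, Nat.choose_one_right]; omega
    have hs : nu (0 + 1) (M - 2 * (0 + 1 : ℕ) + 1) = M := by
      rw [nu_strict _ M hM, Nat.choose_one_right, Nat.choose_one_right]; omega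
    exact ⟨by rw [h.encard_grid_weak hM signPair_one hρ, hw],
      encard_grid_A α h hρc hM signPair_one h0, encard_grid_A α h hρc hM signPair_one h1,
      by rw [h.encard_grid_strict hM signPair_e hρ, hs],
      encard_grid_A α h hρc hM signPair_e h0, encard_grid_A α h hρc hM signPair_e h1⟩
  · intro α hα ρc ρ hρc hρ
    obtain ⟨e, c, h⟩ := exists_isFrame_C (m := 1) α hα
    have h0 := thetaSign_zero (α := α) (e := e)
    have h1 := h.thetaSign_of_shift hρ
    -- In the mixed-parity counts the interval has `M + 1`, `M` or `M - 1` elements as zero, one or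
    -- two endpoints of `[0, M]` are forbidden.
    have g1 : ((M : ℤ) - 1) = ((M + 1 : ℕ) : ℤ) - 2 := by push_cast; ring
    have g3 : ((M : ℤ) - 3) = ((M - 1 : ℕ) : ℤ) - 2 := by omega
    have g3' : ((M : ℤ) - 3) = M - 2 * (1 + 1 : ℕ) + 1 := by push_cast; ring
    refine ⟨⟨h.encard_grid_weak hM signPair_one hρ, ?_, ?_, h.encard_grid_weak hM h.signPair_l_C hρ⟩,
      ⟨?_, ?_, ?_, ?_⟩, ?_, ?_, ?_, ?_⟩
    · rw [g1]
      exact encard_grid_mixed α h hρc hM signPair_one h0 (lo := 0) (fun s => by simp)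
    · rw [g1]
      exact encard_grid_mixed α h hρc hM h.signPair_s_C h0 (lo := 0) (fun s => by simp)
    · exact encard_grid_mixed α h hρc hM signPair_one h1 (lo := 0) (fun s => by simp; omega)
    · exact encard_grid_mixed α h hρc hM signPair_e h1 (lo := 1) (fun s => by simp; omega)
    · exact encard_grid_mixed α h hρc hM h.signPair_s_C h1 (lo := 0) (fun s => by simp; omega)
    · exact encard_grid_mixed α h hρc hM h.signPair_l_C h1 (lo := 1) (fun s => by simp; omega)
    · rw [g3]
      exact encard_grid_mixed α h hρc hM signPair_e h0 (lo := 1) (fun s => by simp; omega)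
    · rw [g3']; exact h.encard_grid_strict hM signPair_e hρ
    · rw [g3']; exact h.encard_grid_strict hM h.signPair_s_C hρ
    · rw [g3]
      exact encard_grid_mixed α h hρc hM h.signPair_l_C h0 (lo := 1) (fun s => by simp; omega)
  · rintro n hn α hα ρ hρ
    obtain ⟨m, rfl⟩ : ∃ m, n = m + 1 := ⟨n - 1, by omega⟩
    obtain ⟨e, c, h⟩ := exists_isFrame_C α hα
    exact ⟨⟨h.encard_grid_weak hM signPair_one hρ, h.encard_grid_weak hM h.signPair_l_C hρ⟩,
      h.encard_grid_strict hM signPair_e hρ, h.encard_grid_strict hM h.signPair_s_C hρ⟩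
  · rintro n hn α hα ρc hρc
    obtain ⟨m, rfl⟩ : ∃ m, n = m + 1 + 1 := ⟨n - 2, by omega⟩
    obtain ⟨e, c, h⟩ := exists_isFrame_B α hα
    exact ⟨⟨h.encard_grid_B_weak hM signPair_one hρc, h.encard_grid_B_weak hM h.signPair_s_B hρc⟩,
      h.encard_grid_B_strict hM signPair_e hρc, h.encard_grid_B_strict hM h.signPair_l_B hρc⟩
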